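/- Let $A$ be an associative ring with $1$ and let $\rho:A\to A$ be a ring automorphism. Let $A_\rho((z))$ be the twisted Novikov ring, whose elements are the formal series $\sum_{j\in\mathbf{Z}}a_jz^j$ with $a_j\in A$ and $a_j=0$ for all but finitely many $j<0$, multiplied according to $az=z\rho(a)$ ($a\in A$), and let $A_\rho[[z]]\subseteq A_\rho((z))$ be the subring of the power series $\sum_{j\geq 0}a_jz^j$. For a ring $R$ let $K_1(R)$ be its Whitehead group, i.e. the abelianization $GL(R)^{ab}$ of the stable general linear group $GL(R)=\bigcup_n GL_n(R)$, written additively, and let $\tau(\alpha)\in K_1(R)$ be the class (torsion) of an invertible matrix $\alpha$. Let $W_1(A,\rho)\subseteq K_1(A_\rho[[z]])$ be the subgroup of the torsions $\tau(w)$ of the Witt vectors, that is, of the units of $A_\rho[[z]]$ (regarded as invertible $1\times 1$ matrices) of the form $w=1+\sum_{j\geq 1}a_jz^j$. Then the homomorphism $$\widehat C_2: W_1(A,\rho)\to K_1(A_\rho((z)))$$ induced by the inclusion $A_\rho[[z]]\subseteq A_\rho((z))$ has a left inverse, i.e. there is a group homomorphism $$\widehat B_2: K_1(A_\rho((z)))\to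 W_1(A,\rho)$$ with $\widehat B_2\circ\widehat C_2=\mathrm{Id}_{W_1(A,\rho)}$, which satisfies: 1. $\widehat B_2$ vanishes on the image of the homomorphism $K_1(A)\to K_1(A_\rho((z)))$ induced by the inclusion $A\subseteq A_\rho((z))$; 2. $\widehat B_2(\tau(z))=0$, where $\tau(z)\in K_1(A_\rho((z)))$ is the torsion of the invertible $1\times 1$ matrix $(z)$. -/

import Mathlib

noncomputable section

/-! ## The Whitehead group `K₁` of an associative ring -/

namespace KTheory

open Matrix

variable {R S : Type*} [Ring R] [Ring S]

/-- The stabilisation `α ↦ α ⊕ 1` of square matrices, from size `n` to size `m ≥ n`. -/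
def stabMatrix {n m : ℕ} (h : n ≤ m) : Matrix (Fin n) (Fin n) R →* Matrix (Fin m) (Fin m) R where
  toFun M := (fromBlocks M 0 0 (1 : Matrix (Fin (m - n)) (Fin (m - n)) R)).submatrix
    (finSumFinEquiv.trans (finCongr (Nat.add_sub_of_le h))).symm
    (finSumFinEquiv.trans (finCongr (Nat.add_sub_of_le h))).symm
  map_one' := by rw [fromBlocks_one, submatrix_one_equiv]
  map_mul' M N := by
    rw [submatrix_mul_equiv, fromBlocks_multiply]
    simp

theorem stabMatrix_apply {n m : ℕ} (h : n ≤ m) (M : Matrix (Fin n) (Fin n) R) (i j : Fin m) :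
    stabMatrix h M i j = if hij : i.1 < n ∧ j.1 < n then M ⟨i.1, hij.1⟩ ⟨j.1, hij.2⟩
      else if i = j then 1 else 0 := by
  obtain ⟨i, rfl⟩ := (finSumFinEquiv.trans (finCongr (Nat.add_sub_of_le h))).surjective i
  obtain ⟨j, rfl⟩ := (finSumFinEquiv.trans (finCongr (Nat.add_sub_of_le h))).surjective j
  have key : ∀ x y, stabMatrix h M
      ((finSumFinEquiv.trans (finCongr (Nat.add_sub_of_le h))) x)
      ((finSumFinEquiv.trans (finCongr (Nat.add_sub_of_le h))) y)
      = fromBlocks M 0 0 (1 : Matrix (Fin (m - n)) (Fin (m - n)) R) x y := by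
    intro x y
    simp [stabMatrix]
  rw [key]
  rcases i with i | i <;> rcases j with j | j
  · simp
  · simp [Fin.ext_iff]
    omega
  · simp [Fin.ext_iff]
    omega
  · simp [Matrix.one_apply, Fin.ext_iff]

/-- The inclusion `GLₙ(R) → GLₘ(R)`, `α ↦ α ⊕ 1`, for `n ≤ m`. -/
def stab (R : Type*) [Ring R] (n m : ℕ) (h : n ≤ m) : GL (Fin n) R →* GL (Fin m) R :=
  Units.map (stabMatrix h)

instance (R : Type*) [Ring R] : DirectedSystem (fun n : ℕ ↦ GL (Fin n) R) (stab R · · ·) where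
  map_self n M := by
    ext i j
    simp [stab, stabMatrix_apply]
  map_map k j i hij hjk M := by
    ext a b
    simp only [stab, Units.coe_map, stabMatrix_apply]
    split_ifs <;> first | rfl | (simp_all; done) | (exfalso; simp_all; omega)

/-- The stable general linear group `GL(R) = ⋃ₙ GLₙ(R)`. -/
abbrev StableGL (R : Type*) [Ring R] : Type _ :=
  DirectLimit (fun n : ℕ ↦ GL (Fin n) R) (stab R)

/-- The Whitehead group `K₁(R) = GL(R)ᵃᵇ`, written additively. -/
abbrev K1 (R : Type*) [Ring R] : Type _ := Additive (Abelianization (StableGL R))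

/-- The canonical homomorphism `GLₙ(R) → GL(R)`. -/
def toStableGL (R : Type*) [Ring R] (n : ℕ) : GL (Fin n) R →* StableGL R where
  toFun M := ⟦⟨n, M⟩⟧
  map_one' := (DirectLimit.one_def (f := stab R) n).symm
  map_mul' M N := (DirectLimit.mul_def (f := stab R) n M N).symm

/-- The torsion `τ(α) ∈ K₁(R)` of an invertible `n × n` matrix `α`. -/
def torsion {n : ℕ} (α : GL (Fin n) R) : K1 R :=
  Additive.ofMul (Abelianization.of (toStableGL R n α))

/-- The homomorphism `Rˣ → K₁(R)` sending a unit to the torsion of the corresponding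
invertible `1 × 1` matrix. -/
def unitTorsion (R : Type*) [Ring R] : Additive Rˣ →+ K1 R where
  toFun u := torsion (Units.map (Matrix.scalar (Fin 1)).toMonoidHom u.toMul)
  map_zero' := by simp [torsion]
  map_add' u v := by simp [torsion]

/-- The map `GLₙ(R) → GLₙ(S)` given by applying a ring homomorphism to all matrix entries. -/
def mapGL (φ : R →+* S) (n : ℕ) : GL (Fin n) R →* GL (Fin n) S :=
  Units.map (φ.mapMatrix (m := Fin n)).toMonoidHom

theorem stab_map (φ : R →+* S) (n m : ℕ) (h : n ≤ m) (M : GL (Fin n) R) :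
    stab S n m h (mapGL φ n M) = mapGL φ m (stab R n m h M) := by
  ext i j
  change stabMatrix h (φ.mapMatrix M.1) i j = φ (stabMatrix h M.1 i j)
  rw [stabMatrix_apply, stabMatrix_apply]
  split_ifs
  · rfl
  · exact φ.map_one.symm
  · exact φ.map_zero.symm

/-- The map `GL(R) → GL(S)` given by applying a ring homomorphism to all matrix entries. -/
def StableGL.map (φ : R →+* S) : StableGL R →* StableGL S where
  toFun := DirectLimit.map (stab R) (stab S)
    (fun n M ↦ mapGL φ n M) (stab_map φ)
  map_one' := by
    rw [DirectLimit.one_def 0, DirectLimit.one_def 0, DirectLimit.map_def]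
    simp only [map_one]
  map_mul' x y := by
    induction x, y using DirectLimit.induction₂ with
    | _ n M N =>
      simp only [DirectLimit.mul_def, DirectLimit.map_def, map_mul]

/-- The homomorphism `K₁(R) → K₁(S)` induced by a ring homomorphism `R → S`. -/
def K1.map (φ : R →+* S) : K1 R →+ K1 S :=
  MonoidHom.toAdditive (Abelianization.map (StableGL.map φ))

end KTheory

/-! ## Twisted power series and the Novikov ring -/

/-- The twisted Novikov ring `A_ρ((z))`: formal series `∑ aⱼ zʲ`, `j ∈ ℤ`, with `aⱼ ∈ A` and
`aⱼ = 0` for all but finitely many `j < 0`. The multiplication is the one for which `a z = z ρ(a)`,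
see below. -/
@[ext]
structure NovikovRing {A : Type*} [Ring A] (ρ : A ≃+* A) where
  /-- The coefficient `aⱼ` of `∑ aⱼ zʲ`. -/
  coeff : ℤ → A
  exists_bound : ∃ k : ℤ, ∀ j < k, coeff j = 0

namespace NovikovRing

variable {A : Type*} [Ring A] {ρ : A ≃+* A}

/-- The monomial `a zʲ`. -/
def monomial (ρ : A ≃+* A) (j : ℤ) (a : A) : NovikovRing ρ where
  coeff i := if i = j then a else 0
  exists_bound := ⟨j, fun _ hi ↦ if_neg hi.ne⟩

instance : Zero (NovikovRing ρ) := ⟨⟨fun _ ↦ 0, 0, fun _ _ ↦ rfl⟩⟩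

instance : One (NovikovRing ρ) := ⟨monomial ρ 0 1⟩

instance : Add (NovikovRing ρ) where
  add f g :=
    { coeff := fun j ↦ f.coeff j + g.coeff j
      exists_bound := by
        obtain ⟨k, hk⟩ := f.exists_bound
        obtain ⟨l, hl⟩ := g.exists_bound
        exact ⟨min k l, fun j hj ↦ by rw [hk j (by omega), hl j (by omega), add_zero]⟩ }

instance : Neg (NovikovRing ρ) where
  neg f :=
    { coeff := fun j ↦ -f.coeff j
      exists_bound := by
        obtain ⟨k, hk⟩ := f.exists_bound
        exact ⟨k, fun j hj ↦ by rw [hk j hj, neg_zero]⟩ }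

/-- The twisted multiplication. Since `a z = z ρ(a)`, one has `zⁱ b = ρ⁻ⁱ(b) zⁱ`, so that
`(∑ aᵢ zⁱ) (∑ bⱼ zʲ) = ∑ₙ (∑ᵢ aᵢ ρ⁻ⁱ(bₙ₋ᵢ)) zⁿ`; only finitely many terms of the inner sum
are nonzero. -/
instance : Mul (NovikovRing ρ) where
  mul f g :=
    { coeff := fun n ↦ ∑ᶠ i : ℤ, f.coeff i * ((ρ : RingAut A) ^ (-i)) (g.coeff (n - i))
      exists_bound := by
        obtain ⟨k, hk⟩ := f.exists_bound
        obtain ⟨l, hl⟩ := g.exists_bound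
        refine ⟨k + l, fun n hn ↦ finsum_eq_zero_of_forall_eq_zero fun i ↦ ?_⟩
        rcases lt_or_ge i k with h | h
        · rw [hk i h, zero_mul]
        · rw [hl (n - i) (by omega), map_zero, mul_zero] }

theorem coeff_zero (j : ℤ) : (0 : NovikovRing ρ).coeff j = 0 := rfl

theorem coeff_monomial (i j : ℤ) (a : A) :
    (monomial ρ i a).coeff j = if j = i then a else 0 := rfl

theorem coeff_one (j : ℤ) : (1 : NovikovRing ρ).coeff j = if j = 0 then 1 else 0 := rfl

theorem coeff_add (f g : NovikovRing ρ) (j : ℤ) :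
    (f + g).coeff j = f.coeff j + g.coeff j := rfl

theorem coeff_neg (f : NovikovRing ρ) (j : ℤ) : (-f).coeff j = -f.coeff j := rfl

theorem coeff_mul (f g : NovikovRing ρ) (n : ℤ) :
    (f * g).coeff n = ∑ᶠ i : ℤ, f.coeff i * ((ρ : RingAut A) ^ (-i)) (g.coeff (n - i)) := rfl

/-- Auxiliary, for the ring axioms: `a zʲ` acts on `A` as `x ↦ a ρ⁻ʲ(x)`. -/
def actionTerm (ρ : A ≃+* A) (j : ℤ) : A →+ AddMonoid.End A where
  toFun a := (AddMonoidHom.mulLeft a).comp (((ρ : RingAut A) ^ (-j) : A ≃+* A) : A →+ A)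
  map_zero' := by
    refine AddMonoidHom.ext fun x ↦ ?_
    change 0 * _ = (0 : A)
    rw [zero_mul]
  map_add' a b := by
    refine AddMonoidHom.ext fun x ↦ ?_
    change (a + b) * _ = a * _ + b * _
    rw [add_mul]

theorem actionTerm_apply (j : ℤ) (a x : A) :
    actionTerm ρ j a x = a * ((ρ : RingAut A) ^ (-j)) x := rfl

theorem actionTerm_injective (j : ℤ) : Function.Injective (actionTerm ρ j) := by
  intro a b h
  have h1 := DFunLike.congr_fun h 1
  rwa [actionTerm_apply, actionTerm_apply, map_one, mul_one, mul_one] at h1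

theorem actionTerm_mul (i j : ℤ) (a b : A) :
    actionTerm ρ i a * actionTerm ρ j b
      = actionTerm ρ (i + j) (a * ((ρ : RingAut A) ^ (-i)) b) := by
  refine AddMonoidHom.ext fun x ↦ ?_
  change a * ((ρ : RingAut A) ^ (-i)) (b * ((ρ : RingAut A) ^ (-j)) x)
    = a * ((ρ : RingAut A) ^ (-i)) b * ((ρ : RingAut A) ^ (-(i + j))) x
  rw [map_mul, mul_assoc, neg_add, zpow_add]
  rfl

theorem actionTerm_one : actionTerm ρ 0 1 = 1 := by
  refine AddMonoidHom.ext fun x ↦ ?_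
  change 1 * ((ρ : RingAut A) ^ (-0 : ℤ)) x = x
  rw [one_mul, neg_zero, zpow_zero]
  rfl

/-- Auxiliary, for the ring axioms: an injective additive and multiplicative map to the
(untwisted) ring of Laurent series over the endomorphism ring of the additive group of `A`. -/
def toEnd (f : NovikovRing ρ) : HahnSeries ℤ (AddMonoid.End A) :=
  HahnSeries.ofSuppBddBelow (fun j ↦ actionTerm ρ j (f.coeff j)) (by
    obtain ⟨k, hk⟩ := f.exists_bound
    refine ⟨k, fun j hj ↦ ?_⟩
    by_contra h
    exact hj (by simp [hk j (by omega)]))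

theorem toEnd_coeff (f : NovikovRing ρ) (j : ℤ) :
    f.toEnd.coeff j = actionTerm ρ j (f.coeff j) := rfl

theorem toEnd_injective : Function.Injective (toEnd (ρ := ρ)) := fun _ _ h ↦
  NovikovRing.ext <| funext fun j ↦
    actionTerm_injective j (congrArg (fun x ↦ HahnSeries.coeff x j) h)

theorem toEnd_zero : (0 : NovikovRing ρ).toEnd = 0 := by
  ext1
  funext j
  rw [toEnd_coeff, coeff_zero, map_zero, HahnSeries.coeff_zero]

theorem toEnd_add (f g : NovikovRing ρ) : (f + g).toEnd = f.toEnd + g.toEnd := by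
  ext1
  funext j
  rw [toEnd_coeff, coeff_add, map_add, HahnSeries.coeff_add, toEnd_coeff, toEnd_coeff]

theorem toEnd_neg (f : NovikovRing ρ) : (-f).toEnd = -f.toEnd := by
  ext1
  funext j
  rw [toEnd_coeff, coeff_neg, map_neg, HahnSeries.coeff_neg, toEnd_coeff]

theorem toEnd_monomial (j : ℤ) (a : A) :
    (monomial ρ j a).toEnd = HahnSeries.single j (actionTerm ρ j a) := by
  ext1
  funext l
  rw [toEnd_coeff, coeff_monomial, HahnSeries.coeff_single]
  by_cases h : l = j
  · rw [if_pos h, if_pos h, h]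
  · rw [if_neg h, if_neg h, map_zero]

theorem toEnd_one : (1 : NovikovRing ρ).toEnd = 1 := by
  change (monomial ρ 0 1).toEnd = _
  rw [toEnd_monomial, actionTerm_one]
  rfl

theorem toEnd_mul (f g : NovikovRing ρ) : (f * g).toEnd = f.toEnd * g.toEnd := by
  ext1
  funext n
  rw [toEnd_coeff, coeff_mul, HahnSeries.coeff_mul]
  have hzero : ∀ (h : NovikovRing ρ) (j : ℤ), h.toEnd.coeff j = 0 ↔ h.coeff j = 0 := fun h j ↦ by
    rw [toEnd_coeff, ← (actionTerm ρ j).map_zero, (actionTerm_injective j).eq_iff]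
  have hinj : Set.InjOn (Prod.fst : ℤ × ℤ → ℤ)
      (Finset.antidiagonal f.toEnd.isPWO_support g.toEnd.isPWO_support n) := by
    intro a ha b hb hab
    have h1 := (Finset.mem_antidiagonal.1 (Finset.mem_coe.1 ha)).2.2
    have h2 := (Finset.mem_antidiagonal.1 (Finset.mem_coe.1 hb)).2.2
    exact Prod.ext hab (by omega)
  rw [finsum_eq_sum_of_support_subset (s := (Finset.antidiagonal f.toEnd.isPWO_support
    g.toEnd.isPWO_support n).image Prod.fst), Finset.sum_image hinj, map_sum]
  · refine Finset.sum_congr rfl fun ij hij ↦ ?_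
    have h := (Finset.mem_antidiagonal.1 hij).2.2
    rw [toEnd_coeff, toEnd_coeff, actionTerm_mul, h, ← h, add_sub_cancel_left]
  · intro i hi
    rw [Finset.coe_image]
    refine ⟨(i, n - i), Finset.mem_coe.2 (Finset.mem_antidiagonal.2 ⟨?_, ?_, by simp⟩), rfl⟩
    · refine fun h ↦ hi ?_
      change f.coeff i * _ = 0
      rw [(hzero f i).1 h, zero_mul]
    · refine fun h ↦ hi ?_
      change _ * ((ρ : RingAut A) ^ (-i)) (g.coeff (n - i)) = 0
      rw [(hzero g (n - i)).1 h, map_zero, mul_zero]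

instance : Ring (NovikovRing ρ) :=
  Ring.ofMinimalAxioms
    (fun f g h ↦ toEnd_injective (by simp only [toEnd_add, add_assoc]))
    (fun f ↦ toEnd_injective (by simp only [toEnd_add, toEnd_zero, zero_add]))
    (fun f ↦ toEnd_injective (by
      rw [toEnd_add, toEnd_neg, toEnd_zero]
      exact neg_add_cancel f.toEnd))
    (fun f g h ↦ toEnd_injective (by simp only [toEnd_mul, mul_assoc]))
    (fun f ↦ toEnd_injective (by simp only [toEnd_mul, toEnd_one, one_mul]))
    (fun f ↦ toEnd_injective (by simp only [toEnd_mul, toEnd_one, mul_one]))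
    (fun f g h ↦ toEnd_injective (by simp only [toEnd_mul, toEnd_add, mul_add]))
    (fun f g h ↦ toEnd_injective (by simp only [toEnd_mul, toEnd_add, add_mul]))

theorem monomial_mul_monomial (i j : ℤ) (a b : A) :
    monomial ρ i a * monomial ρ j b
      = monomial ρ (i + j) (a * ((ρ : RingAut A) ^ (-i)) b) := by
  apply toEnd_injective
  rw [toEnd_mul, toEnd_monomial, toEnd_monomial, toEnd_monomial, HahnSeries.single_mul_single,
    actionTerm_mul]

/-- The inclusion `A → A_ρ((z))`, `a ↦ a z⁰`. -/
def C (ρ : A ≃+* A) : A →+* NovikovRing ρ where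
  toFun := monomial ρ 0
  map_one' := rfl
  map_mul' a b := by
    rw [monomial_mul_monomial, neg_zero, zpow_zero, add_zero]
    rfl
  map_zero' := toEnd_injective (by rw [toEnd_monomial, map_zero, map_zero, toEnd_zero])
  map_add' a b := toEnd_injective (by
    rw [toEnd_add, toEnd_monomial, toEnd_monomial, toEnd_monomial, map_add, HahnSeries.single_add])

/-- The invertible element `z ∈ A_ρ((z))`. -/
def z (ρ : A ≃+* A) : (NovikovRing ρ)ˣ where
  val := monomial ρ 1 1
  inv := monomial ρ (-1) 1
  val_inv := by rw [monomial_mul_monomial, map_one, one_mul]; rfl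
  inv_val := by rw [monomial_mul_monomial, map_one, one_mul]; rfl

/-- The defining relation `a z = z ρ(a)`. -/
theorem C_mul_z (a : A) : C ρ a * (z ρ : NovikovRing ρ) = (z ρ : NovikovRing ρ) * C ρ (ρ a) := by
  change monomial ρ 0 a * monomial ρ 1 1 = monomial ρ 1 1 * monomial ρ 0 (ρ a)
  rw [monomial_mul_monomial, monomial_mul_monomial]
  have : ((ρ : RingAut A) ^ (-1 : ℤ)) (ρ a) = a := by
    rw [zpow_neg_one]
    exact ρ.symm_apply_apply a
  rw [this, map_one, one_mul, mul_one, zero_add, add_zero]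

end NovikovRing

variable {A : Type*} [Ring A]

/-- The twisted power series ring `A_ρ[[z]]`, as the subring of `A_ρ((z))` of all series `∑ aⱼ zʲ`
with `aⱼ = 0` for `j < 0`. -/
def twistedPowerSeries (ρ : A ≃+* A) : Subring (NovikovRing ρ) where
  carrier := {f | ∀ j < 0, f.coeff j = 0}
  zero_mem' j _ := rfl
  one_mem' j hj := by rw [NovikovRing.coeff_one, if_neg hj.ne]
  add_mem' hf hg j hj := by rw [NovikovRing.coeff_add, hf j hj, hg j hj, add_zero]
  neg_mem' hf j hj := by rw [NovikovRing.coeff_neg, hf j hj, neg_zero]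
  mul_mem' {f g} hf hg n hn := by
    refine finsum_eq_zero_of_forall_eq_zero fun i ↦ ?_
    rcases lt_or_ge i 0 with h | h
    · rw [hf i h, zero_mul]
    · rw [hg (n - i) (by omega), map_zero, mul_zero]

/-- The augmentation `A_ρ[[z]] → A`, `∑ aⱼ zʲ ↦ a₀`. -/
def augmentation (ρ : A ≃+* A) : twistedPowerSeries ρ →+* A where
  toFun f := f.1.coeff 0
  map_one' := by simp [NovikovRing.coeff_one]
  map_zero' := rfl
  map_add' f g := rfl
  map_mul' f g := by
    change ∑ᶠ i : ℤ, f.1.coeff i * ((ρ : RingAut A) ^ (-i)) (g.1.coeff (0 - i)) = _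
    rw [finsum_eq_single _ 0]
    · rw [neg_zero, zpow_zero, sub_zero]
      rfl
    · intro i hi
      rcases lt_or_ge i 0 with h | h
      · rw [f.2 i h, zero_mul]
      · rw [g.2 (0 - i) (by omega), map_zero, mul_zero]

/-- The multiplicative group `W(A,ρ)` of Witt vectors: the units of `A_ρ[[z]]` of the form
`1 + a₁ z + a₂ z² + ⋯`. -/
def wittGroup (ρ : A ≃+* A) : Subgroup (twistedPowerSeries ρ)ˣ :=
  (Units.map (augmentation ρ).toMonoidHom).ker

/-- The subgroup `W₁(A,ρ) ⊆ K₁(A_ρ[[z]])` of the torsions `τ(w)` of Witt vectors `w`. -/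
def W1 (ρ : A ≃+* A) : AddSubgroup (KTheory.K1 (twistedPowerSeries ρ)) :=
  (wittGroup ρ).toAddSubgroup.map (KTheory.unitTorsion (twistedPowerSeries ρ))

/-- The homomorphism `Ĉ₂ : W₁(A,ρ) → K₁(A_ρ((z)))` induced by the inclusion
`A_ρ[[z]] ⊆ A_ρ((z))`. -/
def C2 (ρ : A ≃+* A) : W1 ρ →+ KTheory.K1 (NovikovRing ρ) :=
  (KTheory.K1.map (twistedPowerSeries ρ).subtype).comp (W1 ρ).subtype

end

/-! Let ε be the augmentation `A_ρ[[z]] → A` and i the inclusion of `A` in `A_ρ[[z]]`. The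
endomorphism x ↦ x - iε(x) of `K₁(A_ρ[[z]])` is a projection onto `W₁`: its values are torsions of
matrices congruent to 1 modulo z, which Gaussian elimination reduces to Witt vectors
(`wittPart_mem`, `wittPart_eq_self`). It suffices to extend this projection along `K₁(A_ρ[[z]]) →
K₁(A_ρ((z)))` so that τ(z) goes to 0; the image of `K₁(A)` is then killed automatically.

Call a linear pencil δ = δ₀ + δ₁z monic if it has an inverse involving only powers of z with
exponent ≤ 0. After multiplication by a power of z and addition of an identity block, every
invertible matrix over `A_ρ((z))` has the form gδh with g, h invertible over `A_ρ[[z]]` and δ monic.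
The value of the extension is the sum of the Witt parts of g and h. Three facts make this a
homomorphism.

Uniqueness (`wtors_eq_of_mul_eq_mul`): if δg = hδ' with δ, δ' monic, then g and h have the same Witt
part. The pair (g, h) is an isomorphism of two-term complexes from δ' to δ; division by monic
pencils deforms its mapping cone to an invertible matrix with entries in `A`, and such a matrix has
no Witt part.

Multiplicativity (`HasFactorization.mul`): elementary operations over `A_ρ[[z]]` turn the product of
two factorized matrices, plus an identity block, into a block triangular monic pencil.

Existence (`exists_hasStableFactorization`): a matrix without negative powers of z is truncated to a
polynomial, linearised to a pencil, and the pencil is split by idempotents into a part invertible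
over `A_ρ[[z]]` and a part with inverse in negative powers.

Since z is itself monic, τ(z) has value 0, and uniqueness shows that conjugation by z does not
change the value, so powers of z may be moved freely. -/

noncomputable section

namespace KTheory

open Matrix

/-! ### Block matrices and torsions of matrices indexed by arbitrary finite types. -/

section BlockMatrices

variable {R S : Type*} [Ring R] [Ring S] {ι κ ν : Type*} [Fintype ι] [DecidableEq ι] [Fintype κ]
  [DecidableEq κ] [Fintype ν] [DecidableEq ν]

/-- Reindexing of invertible matrices. -/
def reindexGL (e : ι ≃ κ) : GL ι R ≃* GL κ R :=
  Units.mapEquiv (Matrix.reindexRingEquiv R e).toMulEquiv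

theorem coe_reindexGL (e : ι ≃ κ) (g : GL ι R) :
    (reindexGL e g : Matrix κ κ R) = (g : Matrix ι ι R).submatrix e.symm e.symm := rfl

theorem reindexGL_reindexGL (e : ι ≃ κ) (f : κ ≃ ν) (g : GL ι R) :
    reindexGL f (reindexGL e g) = reindexGL (e.trans f) g := rfl

/-- The block sum of two invertible matrices. -/
def blockDiagGL (g : GL ι R) (h : GL κ R) : GL (ι ⊕ κ) R where
  val := fromBlocks g 0 0 h
  inv := fromBlocks ↑g⁻¹ 0 0 ↑h⁻¹
  val_inv := by simp [fromBlocks_multiply]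
  inv_val := by simp [fromBlocks_multiply]

/-- The block matrix `(1 X; 0 1)`. -/
def upperGL (X : Matrix ι κ R) : GL (ι ⊕ κ) R where
  val := fromBlocks 1 X 0 1
  inv := fromBlocks 1 (-X) 0 1
  val_inv := by simp [fromBlocks_multiply]
  inv_val := by simp [fromBlocks_multiply]

/-- The block matrix `(1 0; X 1)`. -/
def lowerGL (X : Matrix κ ι R) : GL (ι ⊕ κ) R where
  val := fromBlocks 1 0 X 1
  inv := fromBlocks 1 0 (-X) 1
  val_inv := by simp [fromBlocks_multiply]
  inv_val := by simp [fromBlocks_multiply]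

variable (ι R) in
/-- The block matrix `(0 -1; 1 0)`. -/
def rotGL : GL (ι ⊕ ι) R where
  val := fromBlocks 0 (-1) 1 0
  inv := fromBlocks 0 1 (-1) 0
  val_inv := by simp [fromBlocks_multiply]
  inv_val := by simp [fromBlocks_multiply]

theorem coe_blockDiagGL (g : GL ι R) (h : GL κ R) :
    (blockDiagGL g h : Matrix (ι ⊕ κ) (ι ⊕ κ) R) = fromBlocks g 0 0 h := rfl

theorem coe_upperGL (X : Matrix ι κ R) :
    (upperGL X : Matrix (ι ⊕ κ) (ι ⊕ κ) R) = fromBlocks 1 X 0 1 := rfl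

theorem coe_lowerGL (X : Matrix κ ι R) :
    (lowerGL X : Matrix (ι ⊕ κ) (ι ⊕ κ) R) = fromBlocks 1 0 X 1 := rfl

theorem upperGL_neg (X : Matrix ι κ R) : upperGL (-X) = (upperGL X)⁻¹ := Units.ext rfl

theorem lowerGL_neg (X : Matrix κ ι R) : lowerGL (-X) = (lowerGL X)⁻¹ := Units.ext rfl

theorem coe_rotGL : (rotGL R ι : Matrix (ι ⊕ ι) (ι ⊕ ι) R) = fromBlocks 0 (-1) 1 0 := rfl

theorem blockDiagGL_mul (g g' : GL ι R) (h h' : GL κ R) :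
    blockDiagGL (g * g') (h * h') = blockDiagGL g h * blockDiagGL g' h' := by
  ext1
  simp [coe_blockDiagGL, fromBlocks_multiply]

/-- Application of a ring homomorphism to the entries of invertible matrices. -/
def mapMatrixGL (φ : R →+* S) : GL ι R →* GL ι S :=
  Units.map (φ.mapMatrix (m := ι)).toMonoidHom

theorem coe_mapMatrixGL (φ : R →+* S) (g : GL ι R) :
    (mapMatrixGL φ g : Matrix ι ι S) = (g : Matrix ι ι R).map φ := rfl

end BlockMatrices

section Torsion

variable {R S : Type*} [Ring R] [Ring S]

theorem torsion_mul {n : ℕ} (g h : GL (Fin n) R) : torsion (g * h) = torsion g + torsion h := by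
  simp [torsion]

theorem torsion_one {n : ℕ} : torsion (1 : GL (Fin n) R) = 0 := by
  simp [torsion]

theorem torsion_stab {n m : ℕ} (h : n ≤ m) (g : GL (Fin n) R) :
    torsion (stab R n m h g) = torsion g := by
  have : toStableGL R m (stab R n m h g) = toStableGL R n g :=
    DirectLimit.mk_apply (f := stab R) (F := fun n : ℕ ↦ GL (Fin n) R) n m g h
  rw [torsion, this, torsion]

/-- Reindexing is conjugation by a permutation matrix, which an abelian group does not see. -/
theorem torsion_reindexGL {n m : ℕ} (e : Fin n ≃ Fin m) (g : GL (Fin n) R) :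
    torsion (reindexGL e g) = torsion g := by
  obtain rfl : n = m := by simpa using Fintype.card_congr e
  let P : GL (Fin n) R :=
    { val := (1 : Matrix (Fin n) (Fin n) R).submatrix e.symm (Equiv.refl _)
      inv := (1 : Matrix (Fin n) (Fin n) R).submatrix (Equiv.refl _) e.symm
      val_inv := by rw [submatrix_mul_equiv, mul_one, submatrix_one_equiv]
      inv_val := by rw [submatrix_mul_equiv, mul_one, submatrix_one_equiv] }
  have h : reindexGL e g * P = P * g := by
    ext1
    have h1 : (P : Matrix (Fin n) (Fin n) R)
      = (1 : Matrix (Fin n) (Fin n) R).submatrix e.symm (Equiv.refl _) := rfl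
    rw [Units.val_mul, Units.val_mul, h1, coe_reindexGL, submatrix_mul_equiv, mul_one]
    conv_rhs => rw [← submatrix_id_id (g : Matrix (Fin n) (Fin n) R)]
    exact ((submatrix_mul_equiv _ _ _ (Equiv.refl _) _).trans (by rw [one_mul]; rfl)).symm
  have h2 := congrArg torsion h
  rw [torsion_mul, torsion_mul, add_comm (torsion P)] at h2
  exact add_right_cancel h2

theorem exists_torsion_eq (x : K1 R) : ∃ (n : ℕ) (g : GL (Fin n) R), x = torsion g := by
  obtain ⟨y, hy⟩ : ∃ y : StableGL R, Abelianization.of y = x.toMul :=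
    QuotientGroup.mk_surjective x.toMul
  obtain ⟨n, g, rfl⟩ := DirectLimit.exists_eq_mk (stab R) y
  exact ⟨n, g, hy.symm⟩

variable {ι κ ν : Type*} [Fintype ι] [DecidableEq ι] [Fintype κ]
  [DecidableEq κ] [Fintype ν] [DecidableEq ν]

/-- The torsion of an invertible matrix with rows and columns indexed by a finite type. -/
def tors (g : GL ι R) : K1 R := torsion (reindexGL (Fintype.equivFin ι) g)

theorem tors_eq_torsion {n : ℕ} (e : ι ≃ Fin n) (g : GL ι R) :
    tors g = torsion (reindexGL e g) := by
  have h : (Fintype.equivFin ι).trans ((Fintype.equivFin ι).symm.trans e) = e := by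
    ext
    simp
  rw [tors, ← torsion_reindexGL ((Fintype.equivFin ι).symm.trans e), reindexGL_reindexGL, h]

theorem tors_fin {n : ℕ} (g : GL (Fin n) R) : tors g = torsion g := by
  rw [tors, torsion_reindexGL]

theorem tors_mul (g h : GL ι R) : tors (g * h) = tors g + tors h := by
  rw [tors, map_mul, torsion_mul, tors, tors]

theorem tors_one : tors (1 : GL ι R) = 0 := by
  rw [tors, map_one, torsion_one]

theorem tors_reindexGL (e : ι ≃ κ) (g : GL ι R) : tors (reindexGL e g) = tors g := by
  rw [tors, reindexGL_reindexGL, ← tors_eq_torsion]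

theorem map_tors (φ : R →+* S) (g : GL ι R) : K1.map φ (tors g) = tors (mapMatrixGL φ g) := rfl

theorem stab_eq_reindexGL {n m : ℕ} (h : n ≤ m) (g : GL (Fin n) R) :
    stab R n m h g = reindexGL (finSumFinEquiv.trans (finCongr (Nat.add_sub_of_le h)))
      (blockDiagGL g (1 : GL (Fin (m - n)) R)) := rfl

theorem tors_blockDiagGL_one (g : GL ι R) : tors (blockDiagGL g (1 : GL κ R)) = tors g := by
  let n := Fintype.card ι
  let m := Fintype.card ι + Fintype.card κ
  have hk : Fintype.card κ = m - n := (Nat.add_sub_cancel_left ..).symm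
  have h : n ≤ m := Nat.le_add_right ..
  have h1 : reindexGL (Equiv.sumCongr (Fintype.equivFin ι) (Fintype.equivFinOfCardEq hk))
      (blockDiagGL g (1 : GL κ R))
      = blockDiagGL (reindexGL (Fintype.equivFin ι) g) (1 : GL (Fin (m - n)) R) := by
    refine Units.ext ?_
    ext i j
    rcases i with i | i <;> rcases j with j | j <;>
      simp [coe_reindexGL, coe_blockDiagGL, Matrix.one_apply]
  rw [← tors_reindexGL (Equiv.sumCongr (Fintype.equivFin ι) (Fintype.equivFinOfCardEq hk)), h1,
    ← tors_reindexGL (finSumFinEquiv.trans (finCongr (Nat.add_sub_of_le h))),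
    ← stab_eq_reindexGL h, tors_fin, torsion_stab]
  rfl

theorem tors_one_blockDiagGL (g : GL κ R) : tors (blockDiagGL (1 : GL ι R) g) = tors g := by
  have h : reindexGL (Equiv.sumComm ι κ) (blockDiagGL (1 : GL ι R) g)
      = blockDiagGL g (1 : GL ι R) := by
    refine Units.ext ?_
    ext i j
    rcases i with i | i <;> rcases j with j | j <;> simp [coe_reindexGL, coe_blockDiagGL]
  rw [← tors_reindexGL (Equiv.sumComm ι κ), h, tors_blockDiagGL_one]

theorem tors_blockDiagGL (g : GL ι R) (h : GL κ R) :
    tors (blockDiagGL g h) = tors g + tors h := by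
  rw [← mul_one g, ← one_mul h, blockDiagGL_mul, tors_mul, tors_blockDiagGL_one,
    tors_one_blockDiagGL, mul_one, one_mul]

/-- After adding a third block, the matrix is the commutator of `U` and `V`: this is the Steinberg
relation [e₁₃(X), e₃₂(1)] = e₁₂(X). -/
theorem tors_upperGL (X : Matrix ι κ R) : tors (upperGL X) = 0 := by
  let U : GL ((ι ⊕ κ) ⊕ κ) R := upperGL (fromRows X (0 : Matrix κ κ R))
  let V : GL ((ι ⊕ κ) ⊕ κ) R := lowerGL (fromCols (0 : Matrix κ ι R) (1 : Matrix κ κ R))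
  have h : U * V = blockDiagGL (upperGL X) (1 : GL κ R) * V * U := by
    refine Units.ext ?_
    ext i j
    rcases i with (i | i) | i <;> rcases j with (j | j) | j <;>
      simp [U, V, coe_upperGL, coe_lowerGL, coe_blockDiagGL, fromBlocks_multiply,
        fromBlocks_apply₁₁, Matrix.mul_apply, Matrix.one_apply, Fintype.sum_sum_type]
  have h1 := congrArg tors h
  rw [tors_mul, tors_mul, tors_mul, tors_blockDiagGL_one, add_assoc, add_comm (tors V)] at h1
  exact left_eq_add.1 (h1.trans (add_comm _ _))

theorem tors_lowerGL (X : Matrix κ ι R) : tors (lowerGL X) = 0 := by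
  have h : reindexGL (Equiv.sumComm ι κ) (lowerGL X) = upperGL X := by
    refine Units.ext ?_
    ext i j
    rcases i with i | i <;> rcases j with j | j <;>
      simp [coe_reindexGL, coe_upperGL, coe_lowerGL, Matrix.one_apply]
  rw [← tors_reindexGL (Equiv.sumComm ι κ), h, tors_upperGL]

end Torsion

end KTheory

/-! ### Order and degree of matrices over the Novikov ring. -/

noncomputable section

namespace NovikovRing

variable {A : Type*} [Ring A] {ρ : A ≃+* A}

theorem coeff_sub (f g : NovikovRing ρ) (j : ℤ) :
    (f - g).coeff j = f.coeff j - g.coeff j := by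
  rw [sub_eq_add_neg, coeff_add, coeff_neg, sub_eq_add_neg]

/-- The additive group of the series with vanishing coefficients in degrees `< d`. -/
def ordGE (ρ : A ≃+* A) (d : ℤ) : AddSubgroup (NovikovRing ρ) where
  carrier := {f | ∀ j < d, f.coeff j = 0}
  zero_mem' _ _ := rfl
  add_mem' hf hg j hj := by rw [coeff_add, hf j hj, hg j hj, add_zero]
  neg_mem' hf j hj := by rw [coeff_neg, hf j hj, neg_zero]

/-- The additive group of the series with vanishing coefficients in degrees `> d`. -/
def degLE (ρ : A ≃+* A) (d : ℤ) : AddSubgroup (NovikovRing ρ) where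
  carrier := {f | ∀ j > d, f.coeff j = 0}
  zero_mem' _ _ := rfl
  add_mem' hf hg j hj := by rw [coeff_add, hf j hj, hg j hj, add_zero]
  neg_mem' hf j hj := by rw [coeff_neg, hf j hj, neg_zero]

theorem mul_mem_ordGE {d e : ℤ} {f g : NovikovRing ρ} (hf : f ∈ ordGE ρ d) (hg : g ∈ ordGE ρ e) :
    f * g ∈ ordGE ρ (d + e) := by
  refine fun n hn ↦ finsum_eq_zero_of_forall_eq_zero fun i ↦ ?_
  rcases lt_or_ge i d with h | h
  · rw [hf i h, zero_mul]
  · rw [hg (n - i) (by omega), map_zero, mul_zero]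

theorem mul_mem_degLE {d e : ℤ} {f g : NovikovRing ρ} (hf : f ∈ degLE ρ d) (hg : g ∈ degLE ρ e) :
    f * g ∈ degLE ρ (d + e) := by
  refine fun n hn ↦ finsum_eq_zero_of_forall_eq_zero fun i ↦ ?_
  rcases lt_or_ge d i with h | h
  · rw [hf i h, zero_mul]
  · rw [hg (n - i) (by omega), map_zero, mul_zero]

theorem monomial_mem_ordGE (j : ℤ) (a : A) : monomial ρ j a ∈ ordGE ρ j :=
  fun _ hi ↦ if_neg hi.ne

theorem monomial_mem_degLE (j : ℤ) (a : A) : monomial ρ j a ∈ degLE ρ j :=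
  fun _ hi ↦ if_neg (ne_of_gt hi)

/-- The sum of the terms of degree `< d`. -/
def below (d : ℤ) (f : NovikovRing ρ) : NovikovRing ρ where
  coeff j := if j < d then f.coeff j else 0
  exists_bound := by
    obtain ⟨k, hk⟩ := f.exists_bound
    exact ⟨k, fun j hj ↦ by rw [hk j hj, ite_self]⟩

end NovikovRing

namespace Matrix

open NovikovRing

variable {A : Type*} [Ring A] {ρ : A ≃+* A} {ι κ ν : Type*}

/-- All entries have vanishing coefficients in degrees `< d`. -/
def OrdGE (d : ℤ) (M : Matrix ι κ (NovikovRing ρ)) : Prop := ∀ i j, M i j ∈ ordGE ρ d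

/-- All entries have vanishing coefficients in degrees `> d`. -/
def DegLE (d : ℤ) (M : Matrix ι κ (NovikovRing ρ)) : Prop := ∀ i j, M i j ∈ degLE ρ d

variable {d e : ℤ} {M N : Matrix ι κ (NovikovRing ρ)}

theorem OrdGE.add (hM : M.OrdGE d) (hN : N.OrdGE d) : (M + N).OrdGE d :=
  fun i j ↦ add_mem (hM i j) (hN i j)

theorem DegLE.add (hM : M.DegLE d) (hN : N.DegLE d) : (M + N).DegLE d :=
  fun i j ↦ add_mem (hM i j) (hN i j)

theorem OrdGE.sub (hM : M.OrdGE d) (hN : N.OrdGE d) : (M - N).OrdGE d :=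
  fun i j ↦ sub_mem (hM i j) (hN i j)

theorem DegLE.sub (hM : M.DegLE d) (hN : N.DegLE d) : (M - N).DegLE d :=
  fun i j ↦ sub_mem (hM i j) (hN i j)

theorem OrdGE.neg (hM : M.OrdGE d) : (-M).OrdGE d := fun i j ↦ neg_mem (hM i j)

theorem DegLE.neg (hM : M.DegLE d) : (-M).DegLE d := fun i j ↦ neg_mem (hM i j)

theorem OrdGE.zero : (0 : Matrix ι κ (NovikovRing ρ)).OrdGE d := fun _ _ ↦ zero_mem _

theorem DegLE.zero : (0 : Matrix ι κ (NovikovRing ρ)).DegLE d := fun _ _ ↦ zero_mem _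

theorem OrdGE.mono (hM : M.OrdGE d) (h : e ≤ d) : M.OrdGE e :=
  fun i j k hk ↦ hM i j k (hk.trans_le h)

theorem DegLE.mono (hM : M.DegLE d) (h : d ≤ e) : M.DegLE e :=
  fun i j k hk ↦ hM i j k (lt_of_le_of_lt h hk)

/-- The device behind the vanishing statements below: one expression for a matrix bounds its order,
another bounds its degree. -/
theorem eq_zero_of_ordGE_of_degLE (hM : M.OrdGE d) (hM' : M.DegLE e) (h : e < d) : M = 0 := by
  ext i j k
  rcases lt_or_ge k d with hk | hk
  · exact hM i j k hk
  · exact hM' i j k (h.trans_le hk)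

theorem OrdGE.mul [Fintype κ] {M : Matrix ι κ (NovikovRing ρ)} {N : Matrix κ ν (NovikovRing ρ)}
    (hM : M.OrdGE d) (hN : N.OrdGE e) : (M * N).OrdGE (d + e) :=
  fun i j ↦ sum_mem fun k _ ↦ mul_mem_ordGE (hM i k) (hN k j)

theorem DegLE.mul [Fintype κ] {M : Matrix ι κ (NovikovRing ρ)} {N : Matrix κ ν (NovikovRing ρ)}
    (hM : M.DegLE d) (hN : N.DegLE e) : (M * N).DegLE (d + e) :=
  fun i j ↦ sum_mem fun k _ ↦ mul_mem_degLE (hM i k) (hN k j)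

theorem OrdGE.scalar [Fintype ι] [DecidableEq ι] {f : NovikovRing ρ} (hf : f ∈ ordGE ρ d) :
    (Matrix.scalar ι f).OrdGE d := by
  intro i j
  rw [scalar_apply, diagonal_apply]
  split_ifs
  exacts [hf, zero_mem _]

theorem DegLE.scalar [Fintype ι] [DecidableEq ι] {f : NovikovRing ρ} (hf : f ∈ degLE ρ d) :
    (Matrix.scalar ι f).DegLE d := by
  intro i j
  rw [scalar_apply, diagonal_apply]
  split_ifs
  exacts [hf, zero_mem _]

theorem OrdGE.one [Fintype ι] [DecidableEq ι] : (1 : Matrix ι ι (NovikovRing ρ)).OrdGE 0 := by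
  rw [← map_one (Matrix.scalar ι)]
  exact OrdGE.scalar (monomial_mem_ordGE 0 1)

theorem DegLE.one [Fintype ι] [DecidableEq ι] : (1 : Matrix ι ι (NovikovRing ρ)).DegLE 0 := by
  rw [← map_one (Matrix.scalar ι)]
  exact DegLE.scalar (monomial_mem_degLE 0 1)

theorem OrdGE.fromBlocks {ι' κ' : Type*} {M : Matrix ι κ (NovikovRing ρ)}
    {N : Matrix ι κ' (NovikovRing ρ)} {P : Matrix ι' κ (NovikovRing ρ)}
    {Q : Matrix ι' κ' (NovikovRing ρ)} (hM : M.OrdGE d) (hN : N.OrdGE d) (hP : P.OrdGE d)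
    (hQ : Q.OrdGE d) : (Matrix.fromBlocks M N P Q).OrdGE d := by
  rintro (i | i) (j | j)
  exacts [hM i j, hN i j, hP i j, hQ i j]

theorem DegLE.fromBlocks {ι' κ' : Type*} {M : Matrix ι κ (NovikovRing ρ)}
    {N : Matrix ι κ' (NovikovRing ρ)} {P : Matrix ι' κ (NovikovRing ρ)}
    {Q : Matrix ι' κ' (NovikovRing ρ)} (hM : M.DegLE d) (hN : N.DegLE d) (hP : P.DegLE d)
    (hQ : Q.DegLE d) : (Matrix.fromBlocks M N P Q).DegLE d := by
  rintro (i | i) (j | j)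
  exacts [hM i j, hN i j, hP i j, hQ i j]

theorem exists_add_eq (d : ℤ) (M : Matrix ι κ (NovikovRing ρ)) :
    ∃ P Q : Matrix ι κ (NovikovRing ρ), P.OrdGE d ∧ Q.DegLE (d - 1) ∧ P + Q = M := by
  refine ⟨M - M.map (below d), M.map (below d), fun i j k hk ↦ ?_, fun i j k hk ↦ ?_,
    sub_add_cancel _ _⟩
  · change (M i j - below d (M i j)).coeff k = 0
    rw [coeff_sub, sub_eq_zero]
    exact (if_pos hk).symm
  · exact if_neg (by omega)

theorem exists_ordGE [Finite ι] [Finite κ] (M : Matrix ι κ (NovikovRing ρ)) :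
    ∃ k : ℕ, M.OrdGE (-k) := by
  have h : ∀ p : ι × κ, ∃ k : ℕ, M p.1 p.2 ∈ ordGE ρ (-k) := fun p ↦ by
    obtain ⟨k, hk⟩ := (M p.1 p.2).exists_bound
    exact ⟨k.natAbs, fun j hj ↦ hk j (by omega)⟩
  choose k hk using h
  obtain ⟨K, hK⟩ := (Set.finite_range k).bddAbove
  refine ⟨K, fun i j n hn ↦ hk (i, j) n ?_⟩
  have := hK ⟨(i, j), rfl⟩
  omega

section Square

variable [Fintype ι] [DecidableEq ι]

theorem OrdGE.pow {X : Matrix ι ι (NovikovRing ρ)} (hX : X.OrdGE 1) (n : ℕ) :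
    (X ^ n).OrdGE n := by
  induction n with
  | zero => exact OrdGE.one
  | succ n ih =>
    rw [pow_succ]
    exact_mod_cast ih.mul hX

/-- The geometric series of `X` converges z-adically. -/
theorem exists_inverse_one_sub {X : Matrix ι ι (NovikovRing ρ)} (hX : X.OrdGE 1) :
    ∃ G : Matrix ι ι (NovikovRing ρ), G.OrdGE 0 ∧ (1 - X) * G = 1 ∧ G * (1 - X) = 1 := by
  let s : ℕ → Matrix ι ι (NovikovRing ρ) := fun n ↦ ∑ i ∈ Finset.range n, X ^ i
  -- The coefficient of zⁿ no longer changes after the partial sum `s (n + 1)`, because Xᵏ has order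
  -- at least k.
  let G : Matrix ι ι (NovikovRing ρ) := of fun i j ↦
    { coeff := fun n ↦ if n < 0 then 0 else (s (n.toNat + 1) i j).coeff n
      exists_bound := ⟨0, fun n hn ↦ if_pos hn⟩ }
  have hG0 : G.OrdGE 0 := fun i j n hn ↦ if_pos hn
  have hs0 : ∀ n, (s n).OrdGE 0 := fun n i j ↦ by
    change (∑ k ∈ Finset.range n, X ^ k) i j ∈ ordGE ρ 0
    rw [Matrix.sum_apply]
    exact sum_mem fun k _ ↦ ((hX.pow k).mono (by omega)) i j
  have hs : ∀ (n N : ℕ), n < N → ∀ i j, (s N i j).coeff n = (s (n + 1) i j).coeff n := by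
    intro n N h i j
    induction N, (h : n + 1 ≤ N) using Nat.le_induction with
    | base => rfl
    | succ N hN ih =>
      have : s (N + 1) = s N + X ^ N := Finset.sum_range_succ ..
      rw [this, Matrix.add_apply, coeff_add, ih, hX.pow N i j n (by omega), add_zero]
  have hGs : ∀ N : ℕ, (G - s N).OrdGE N := by
    intro N i j n hn
    rw [Matrix.sub_apply, coeff_sub, sub_eq_zero]
    rcases lt_or_ge n 0 with h | h
    · rw [hG0 i j n h, hs0 N i j n h]
    · lift n to ℕ using h
      rw [hs n N (by omega)]
      change (if (n : ℤ) < 0 then 0 else (s (n + 1) i j).coeff n) = _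
      exact if_neg (not_lt.2 (Int.natCast_nonneg n))
  have hX0 : (1 - X).OrdGE 0 := OrdGE.one.sub (hX.mono (by omega))
  refine ⟨G, hG0, sub_eq_zero.1 ?_, sub_eq_zero.1 ?_⟩
  · ext i j n
    have h : ((1 - X) * G - 1).OrdGE (n.toNat + 1 : ℕ) := by
      have h1 : (1 - X) * G - 1 = (1 - X) * (G - s (n.toNat + 1)) - X ^ (n.toNat + 1) := by
        rw [mul_sub, mul_neg_geom_sum]
        abel
      rw [h1]
      exact (by simpa using hX0.mul (hGs (n.toNat + 1)) : OrdGE _ _).sub (hX.pow _)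
    exact h i j n (by omega)
  · ext i j n
    have h : (G * (1 - X) - 1).OrdGE (n.toNat + 1 : ℕ) := by
      have h1 : G * (1 - X) - 1 = (G - s (n.toNat + 1)) * (1 - X) - X ^ (n.toNat + 1) := by
        rw [sub_mul, geom_sum_mul_neg]
        abel
      rw [h1]
      exact (by simpa using (hGs (n.toNat + 1)).mul hX0 : OrdGE _ _).sub (hX.pow _)
    exact h i j n (by omega)

end Square

theorem OrdGE.exists_map_eq (hM : M.OrdGE 0) :
    ∃ N : Matrix ι κ (twistedPowerSeries ρ), N.map (twistedPowerSeries ρ).subtype = M :=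
  ⟨of fun i j ↦ ⟨M i j, hM i j⟩, rfl⟩

theorem ordGE_map (N : Matrix ι κ (twistedPowerSeries ρ)) :
    (N.map (twistedPowerSeries ρ).subtype).OrdGE 0 := fun i j ↦ (N i j).2

theorem map_subtype_injective : Function.Injective
    fun N : Matrix ι κ (twistedPowerSeries ρ) ↦ N.map (twistedPowerSeries ρ).subtype :=
  Matrix.map_injective Subtype.val_injective

end Matrix

/-! ### The Witt vector part of the Whitehead group of the power series ring. -/

noncomputable section

open KTheory Matrix NovikovRing

theorem map_ringHom_sub {α β ι κ : Type*} [Ring α] [Ring β] (φ : α →+* β) (M N : Matrix ι κ α) :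
    (M - N).map φ = M.map φ - N.map φ := Matrix.map_sub φ (map_sub φ) M N

section WittPart

variable {A : Type*} [Ring A] {ρ : A ≃+* A} {ι κ : Type*} [Fintype ι] [DecidableEq ι] [Fintype κ]
  [DecidableEq κ]

/-- The inclusion `A → A_ρ[[z]]`. -/
def constPowerSeries (ρ : A ≃+* A) : A →+* twistedPowerSeries ρ :=
  (NovikovRing.C ρ).codRestrict (twistedPowerSeries ρ) fun a ↦ monomial_mem_ordGE 0 a

/-- The endomorphism `a₀ + a₁ z + ⋯ ↦ a₀` of `A_ρ[[z]]`. -/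
def constantTerm (ρ : A ≃+* A) : twistedPowerSeries ρ →+* twistedPowerSeries ρ :=
  (constPowerSeries ρ).comp (augmentation ρ)

theorem augmentation_constPowerSeries (a : A) : augmentation ρ (constPowerSeries ρ a) = a := by
  change (if (0 : ℤ) = 0 then a else 0) = a
  exact if_pos rfl

theorem constantTerm_eq_self {f : twistedPowerSeries ρ} (hf : (f : NovikovRing ρ) ∈ degLE ρ 0) :
    constantTerm ρ f = f := by
  apply Subtype.ext
  ext j
  change (if j = 0 then f.1.coeff 0 else 0) = f.1.coeff j
  split_ifs with h
  · rw [h]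
  · rcases lt_or_gt_of_ne h with h | h
    · exact (f.2 j h).symm
    · exact (hf j h).symm

theorem ordGE_one_of_augmentation_eq_zero {f : twistedPowerSeries ρ} (hf : augmentation ρ f = 0) :
    (f : NovikovRing ρ) ∈ ordGE ρ 1 := by
  intro j hj
  rcases (Int.lt_add_one_iff.1 hj : j ≤ 0).lt_or_eq with h | rfl
  · exact f.2 j h
  · exact hf

theorem exists_GL_of_map_augmentation_eq_one {M : Matrix ι ι (twistedPowerSeries ρ)}
    (hM : M.map (augmentation ρ) = 1) :
    ∃ g : GL ι (twistedPowerSeries ρ), g.val = M := by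
  have hX : ((1 - M).map (twistedPowerSeries ρ).subtype).OrdGE 1 := fun i j ↦ by
    refine ordGE_one_of_augmentation_eq_zero ?_
    have h := congrFun (congrFun (map_ringHom_sub (augmentation ρ) 1 M) i) j
    rw [hM, Matrix.map_one _ (map_zero _) (map_one _), sub_self] at h
    exact h
  obtain ⟨G, hG, h1, h2⟩ := exists_inverse_one_sub hX
  obtain ⟨N, rfl⟩ := hG.exists_map_eq
  have h3 : 1 - (1 - M).map (twistedPowerSeries ρ).subtype
      = M.map (twistedPowerSeries ρ).subtype := by
    rw [map_ringHom_sub, Matrix.map_one _ (map_zero _) (map_one _), sub_sub_cancel]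
  rw [h3, ← Matrix.map_mul] at h1 h2
  refine ⟨⟨M, N, map_subtype_injective ?_, map_subtype_injective ?_⟩, rfl⟩
  · exact h1.trans (Matrix.map_one _ (map_zero _) (map_one _)).symm
  · exact h2.trans (Matrix.map_one _ (map_zero _) (map_one _)).symm

theorem tors_mem_W1_of_unique (g : GL (Fin 1) (twistedPowerSeries ρ))
    (hg : g.val.map (augmentation ρ) = 1) : tors g ∈ W1 ρ := by
  let w : (twistedPowerSeries ρ)ˣ :=
    { val := g.val 0 0
      inv := g⁻¹.val 0 0
      val_inv := by simpa [Matrix.mul_apply] using congrFun (congrFun g.mul_inv 0) 0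
      inv_val := by simpa [Matrix.mul_apply] using congrFun (congrFun g.inv_mul 0) 0 }
  refine ⟨Additive.ofMul w, ?_, ?_⟩
  · change Units.map _ w = 1
    ext1
    exact congrFun (congrFun hg 0) 0
  · rw [tors_fin]
    change torsion _ = _
    congr 1
    ext i j
    fin_cases i
    fin_cases j
    rfl

/-- Gaussian elimination: the upper left block is 1 modulo z, hence invertible, and its Schur
complement is a 1 × 1 matrix that is again 1 modulo z. -/
theorem torsion_mem_W1 {n : ℕ} (g : GL (Fin n) (twistedPowerSeries ρ))
    (hg : g.val.map (augmentation ρ) = 1) : torsion g ∈ W1 ρ := by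
  induction n with
  | zero =>
    rw [Subsingleton.elim g 1, torsion_one]
    exact zero_mem _
  | succ n ih =>
    rw [← tors_fin, ← tors_reindexGL finSumFinEquiv.symm]
    set h := reindexGL finSumFinEquiv.symm g with hh
    have he : h.val.map (augmentation ρ) = 1 := by
      rw [hh, coe_reindexGL, ← submatrix_map, hg, submatrix_one_equiv]
    rw [← fromBlocks_toBlocks h.val, fromBlocks_map, ← fromBlocks_one, fromBlocks_inj] at he
    obtain ⟨he₁₁, -, he₂₁, he₂₂⟩ := he
    obtain ⟨a, ha⟩ := exists_GL_of_map_augmentation_eq_one he₁₁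
    set b := h.val.toBlocks₁₂
    set c := h.val.toBlocks₂₁
    set d := h.val.toBlocks₂₂
    have hb : h.val = fromBlocks a b c d := by rw [ha, fromBlocks_toBlocks]
    have hd : (d - c * a⁻¹.val * b).map (augmentation ρ) = 1 := by
      rw [map_ringHom_sub, Matrix.map_mul, Matrix.map_mul, he₂₁, he₂₂, Matrix.zero_mul,
        Matrix.zero_mul, sub_zero]
    obtain ⟨d', hd'⟩ := exists_GL_of_map_augmentation_eq_one hd
    have hf : h = lowerGL (c * a⁻¹.val) * blockDiagGL a d' * upperGL (a⁻¹.val * b) := by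
      refine Units.ext ?_
      rw [hb, Units.val_mul, Units.val_mul, coe_lowerGL, coe_blockDiagGL, coe_upperGL, hd',
        fromBlocks_multiply, fromBlocks_multiply]
      have h1 : a.val * a⁻¹.val = 1 := a.mul_inv
      have h2 : a⁻¹.val * a.val = 1 := a.inv_mul
      simp only [Matrix.one_mul, Matrix.mul_one, Matrix.zero_mul, Matrix.mul_zero, add_zero,
        zero_add, ← Matrix.mul_assoc, h1]
      rw [Matrix.mul_assoc c a⁻¹.val a.val, h2, Matrix.mul_one, add_sub_cancel]
    rw [hf, tors_mul, tors_mul, tors_lowerGL, tors_upperGL, tors_blockDiagGL, zero_add, add_zero,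
      tors_fin]
    exact add_mem (ih a (by rw [ha, he₁₁])) (tors_mem_W1_of_unique d' (by rw [hd', hd]))

/-- The endomorphism `x ↦ x - i ε (x)` of `K₁(A_ρ[[z]])`, for the inclusion `i` and the
augmentation `ε`. -/
def wittPart (ρ : A ≃+* A) : K1 (twistedPowerSeries ρ) →+ K1 (twistedPowerSeries ρ) :=
  AddMonoidHom.id _ - K1.map (constantTerm ρ)

theorem wittPart_tors (g : GL ι (twistedPowerSeries ρ)) :
    wittPart ρ (tors g) = tors (g * (mapMatrixGL (constantTerm ρ) g)⁻¹) := by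
  have h : tors (mapMatrixGL (constantTerm ρ) g)⁻¹ = - tors (mapMatrixGL (constantTerm ρ) g) := by
    rw [eq_neg_iff_add_eq_zero, ← tors_mul, inv_mul_cancel, tors_one]
  rw [tors_mul, h, ← sub_eq_add_neg]
  rfl

/-- As εiε = ε, the matrix g · (iε(g))⁻¹ is 1 modulo z. -/
theorem wittPart_mem (x : K1 (twistedPowerSeries ρ)) : wittPart ρ x ∈ W1 ρ := by
  obtain ⟨n, g, rfl⟩ := exists_torsion_eq x
  rw [← tors_fin, wittPart_tors, tors_fin]
  refine torsion_mem_W1 _ ?_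
  have h : mapMatrixGL (augmentation ρ) (mapMatrixGL (constantTerm ρ) g)
      = mapMatrixGL (augmentation ρ) g := by
    refine Units.ext ?_
    ext i j
    exact augmentation_constPowerSeries (ρ := ρ) _
  have h1 : mapMatrixGL (augmentation ρ) (g * (mapMatrixGL (constantTerm ρ) g)⁻¹) = 1 := by
    rw [map_mul, map_inv, h, mul_inv_cancel]
  exact congrArg Units.val h1

theorem wittPart_eq_self {x : K1 (twistedPowerSeries ρ)} (hx : x ∈ W1 ρ) : wittPart ρ x = x := by
  obtain ⟨w, hw, rfl⟩ := hx
  change unitTorsion _ w - K1.map (constantTerm ρ) (unitTorsion _ w) = unitTorsion _ w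
  rw [sub_eq_self]
  have h : mapMatrixGL (constantTerm ρ)
      (Units.map (Matrix.scalar (Fin 1)).toMonoidHom w.toMul) = 1 := by
    refine Units.ext ?_
    ext i j
    fin_cases i
    fin_cases j
    have h1 : augmentation ρ w.toMul.val = 1 := congrArg Units.val hw
    change (constPowerSeries ρ (augmentation ρ w.toMul.val)).1.coeff _ = _
    rw [h1, map_one]
    rfl
  change torsion (mapMatrixGL (constantTerm ρ) _) = 0
  rw [h, torsion_one]

/-- The Witt vector part of the torsion of an invertible matrix over `A_ρ[[z]]`. -/
def wtors (g : GL ι (twistedPowerSeries ρ)) : K1 (twistedPowerSeries ρ) := wittPart ρ (tors g)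

theorem wtors_mul (g h : GL ι (twistedPowerSeries ρ)) : wtors (g * h) = wtors g + wtors h := by
  rw [wtors, tors_mul, map_add, wtors, wtors]

theorem wtors_one : wtors (1 : GL ι (twistedPowerSeries ρ)) = 0 := by
  rw [wtors, tors_one, map_zero]

theorem wtors_inv (g : GL ι (twistedPowerSeries ρ)) : wtors g⁻¹ = -wtors g := by
  rw [eq_neg_iff_add_eq_zero, ← wtors_mul, inv_mul_cancel, wtors_one]

theorem wtors_reindexGL (e : ι ≃ κ) (g : GL ι (twistedPowerSeries ρ)) :
    wtors (reindexGL e g) = wtors g := by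
  rw [wtors, tors_reindexGL, wtors]

theorem wtors_blockDiagGL (g : GL ι (twistedPowerSeries ρ)) (h : GL κ (twistedPowerSeries ρ)) :
    wtors (blockDiagGL g h) = wtors g + wtors h := by
  rw [wtors, tors_blockDiagGL, map_add, wtors, wtors]

theorem wtors_upperGL (X : Matrix ι κ (twistedPowerSeries ρ)) : wtors (upperGL X) = 0 := by
  rw [wtors, tors_upperGL, map_zero]

theorem wtors_lowerGL (X : Matrix κ ι (twistedPowerSeries ρ)) : wtors (lowerGL X) = 0 := by
  rw [wtors, tors_lowerGL, map_zero]

/-- Such a matrix has entries in `A`, so it is its own image under iε. -/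
theorem wtors_eq_zero_of_degLE {g : GL ι (twistedPowerSeries ρ)}
    (hg : (g.val.map (twistedPowerSeries ρ).subtype).DegLE 0) : wtors g = 0 := by
  have h : mapMatrixGL (constantTerm ρ) g = g := by
    refine Units.ext ?_
    ext1 i j
    exact constantTerm_eq_self (hg i j)
  rw [wtors, wittPart_tors, h, mul_inv_cancel, tors_one]

theorem wtors_rotGL : wtors (rotGL (twistedPowerSeries ρ) ι) = 0 := by
  refine wtors_eq_zero_of_degLE ?_
  rw [coe_rotGL, fromBlocks_map, Matrix.map_zero _ (map_zero _), Matrix.map_neg _ (map_neg _),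
    Matrix.map_one _ (map_zero _) (map_one _)]
  exact .fromBlocks .zero DegLE.one.neg DegLE.one .zero

end WittPart

end

/-! ### Monic pencils and the comparison of Witt parts. -/

noncomputable section

open KTheory Matrix NovikovRing

/-- The identities behind the comparison of two presentations of the same cokernel. -/
theorem comparison_identities {T : Type*} [Ring T] {δ δ' g g' h h' : T} (H : δ * g = h * δ')
    (hg : g * g' = 1) (hh : h * h' = 1) (hh' : h' * h = 1) (y y' : T) :
    δ * (g * y' + y * (h' - δ' * y')) = 1 - (h - δ * y) * (h' - δ' * y') ∧
    δ' * (g' * y + y' * (h - δ * y)) = 1 - (h' - δ' * y') * (h - δ * y) ∧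
    (g - y * δ') * (g' - y' * δ) = 1 - (g * y' + y * (h' - δ' * y')) * δ ∧
    (g - y * δ') * (g' * y + y' * (h - δ * y))
      = (g * y' + y * (h' - δ' * y')) * (h - δ * y) := by
  have H' : δ' * g' = h' * δ := by
    calc δ' * g' = h' * h * δ' * g' := by rw [hh', one_mul]
      _ = h' * (δ * g) * g' := by rw [H]; noncomm_ring
      _ = h' * δ * (g * g') := by noncomm_ring
      _ = h' * δ := by rw [hg, mul_one]
  refine ⟨?_, ?_, ?_, ?_⟩ <;> rw [← sub_eq_zero]
  · calc _ = (δ * g - h * δ') * y' + (h * h' - 1) := by noncomm_ring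
      _ = 0 := by rw [H, hh]; noncomm_ring
  · calc _ = (δ' * g' - h' * δ) * y + (h' * h - 1) := by noncomm_ring
      _ = 0 := by rw [H', hh']; noncomm_ring
  · calc _ = (g * g' - 1) - y * (δ' * g' - h' * δ) := by noncomm_ring
      _ = 0 := by rw [H', hg]; noncomm_ring
  · calc _ = (g * g' - 1) * y - y * (h' * h - 1) - y * (δ' * g' - h' * δ) * y := by noncomm_ring
      _ = 0 := by rw [H', hg, hh']; noncomm_ring

variable {A : Type*} [Ring A] {ρ : A ≃+* A} {ι κ : Type*} [Fintype ι] [DecidableEq ι] [Fintype κ]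
  [DecidableEq κ]

/-- `δ = δ₀ + δ₁ z` is a linear polynomial with an inverse `E` in the matrices over `A_ρ((z))`
which is a series in `z⁻¹`. -/
structure IsMonicPair (δ E : Matrix ι ι (NovikovRing ρ)) : Prop where
  ord : δ.OrdGE 0
  deg : δ.DegLE 1
  deg_inv : E.DegLE 0
  mul_inv : δ * E = 1
  inv_mul : E * δ = 1

/-- Division with remainder: y is the power series part of E h, and the remainder h - δy is δ times
the part of E h in negative degrees, so its degree is at most 1 - 1. -/
theorem IsMonicPair.exists_div {δ E : Matrix ι ι (NovikovRing ρ)} (hδ : IsMonicPair δ E)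
    (h : Matrix ι ι (NovikovRing ρ)) : ∃ y : Matrix ι ι (NovikovRing ρ),
      y.OrdGE 0 ∧ (E * h - y).DegLE (-1) ∧ (h - δ * y).DegLE 0 := by
  obtain ⟨y, t, hy, ht, h1⟩ := exists_add_eq 0 (E * h)
  have h2 : E * h - y = t := by rw [← h1, add_sub_cancel_left]
  refine ⟨y, hy, h2 ▸ ht, ?_⟩
  have h3 : h - δ * y = δ * t := by
    rw [← h2, mul_sub, ← mul_assoc, hδ.mul_inv, one_mul]
  rw [h3]
  exact hδ.deg.mul ht

theorem mapMatrixGL_upperGL {R S : Type*} [Ring R] [Ring S] (φ : R →+* S) (X : Matrix ι κ R) :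
    mapMatrixGL φ (upperGL X) = upperGL (X.map φ) := by
  refine Units.ext ?_
  rw [coe_mapMatrixGL, coe_upperGL, coe_upperGL, fromBlocks_map, Matrix.map_zero _ (map_zero _),
    Matrix.map_one _ (map_zero _) (map_one _), Matrix.map_one _ (map_zero _) (map_one _)]

theorem mapMatrixGL_lowerGL {R S : Type*} [Ring R] [Ring S] (φ : R →+* S) (X : Matrix κ ι R) :
    mapMatrixGL φ (lowerGL X) = lowerGL (X.map φ) := by
  refine Units.ext ?_
  rw [coe_mapMatrixGL, coe_lowerGL, coe_lowerGL, fromBlocks_map, Matrix.map_zero _ (map_zero _),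
    Matrix.map_one _ (map_zero _) (map_one _), Matrix.map_one _ (map_zero _) (map_one _)]

theorem mapMatrixGL_blockDiagGL {R S : Type*} [Ring R] [Ring S] (φ : R →+* S) (g : GL ι R)
    (h : GL κ R) :
    mapMatrixGL φ (blockDiagGL g h) = blockDiagGL (mapMatrixGL φ g) (mapMatrixGL φ h) := by
  refine Units.ext ?_
  rw [coe_mapMatrixGL, coe_blockDiagGL, coe_blockDiagGL, fromBlocks_map,
    Matrix.map_zero _ (map_zero _), Matrix.map_zero _ (map_zero _)]
  rfl

theorem mapMatrixGL_rotGL {R S : Type*} [Ring R] [Ring S] (φ : R →+* S) :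
    mapMatrixGL φ (rotGL R ι) = rotGL S ι := by
  refine Units.ext ?_
  rw [coe_mapMatrixGL, coe_rotGL, coe_rotGL, fromBlocks_map, Matrix.map_zero _ (map_zero _),
    Matrix.map_neg _ (map_neg _), Matrix.map_one _ (map_zero _) (map_one _)]

/-- The inclusion of the invertible matrices over `A_ρ[[z]]` in those over `A_ρ((z))`. -/
abbrev inclGL : GL ι (twistedPowerSeries ρ) →* GL ι (NovikovRing ρ) :=
  mapMatrixGL (twistedPowerSeries ρ).subtype

theorem ordGE_inclGL (g : GL ι (twistedPowerSeries ρ)) : (inclGL g).val.OrdGE 0 := ordGE_map _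

/-- A mapping cone argument: y and y' change h and h⁻¹ by homotopies into the constant remainders c
= h - δy and c' = h⁻¹ - δ'y', and u, v are the homotopies between cc', c'c and 1. -/
theorem wtors_eq_of_mul_eq_mul {δ E δ' E' : Matrix ι ι (NovikovRing ρ)} (hδ : IsMonicPair δ E)
    (hδ' : IsMonicPair δ' E') {g h : GL ι (twistedPowerSeries ρ)}
    (H : δ * inclGL g = inclGL h * δ') : wtors g = wtors h := by
  have hg : (inclGL g).val * (inclGL g⁻¹).val = 1 := by rw [← Units.val_mul, ← map_mul]; simp
  have hh : (inclGL h).val * (inclGL h⁻¹).val = 1 := by rw [← Units.val_mul, ← map_mul]; simp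
  have hh' : (inclGL h⁻¹).val * (inclGL h).val = 1 := by rw [← Units.val_mul, ← map_mul]; simp
  have h0g := ordGE_inclGL g
  obtain ⟨y, hy, hyt, hyc⟩ := hδ.exists_div (inclGL h)
  obtain ⟨y', hy', hyt', hyc'⟩ := hδ'.exists_div (inclGL h⁻¹)
  have h0h := ordGE_inclGL h
  have h0h' := ordGE_inclGL h⁻¹
  obtain ⟨e1, e2, e3, e4⟩ := comparison_identities H hg hh hh' y y'
  -- From g⁻¹ = E'h⁻¹δ it follows that g⁻¹ - y'δ is a series in negative degrees times a pencil,
  -- hence of degree at most 0.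
  have hk' : (E' * (inclGL h⁻¹).val - y') * δ = (inclGL g⁻¹).val - y' * δ := by
    have : E' * (inclGL h⁻¹).val * δ = (inclGL g⁻¹).val := by
      calc E' * (inclGL h⁻¹).val * δ
          = E' * (inclGL h⁻¹).val * δ * ((inclGL g).val * (inclGL g⁻¹).val) := by
            rw [hg, mul_one]
        _ = E' * (inclGL h⁻¹).val * (δ * (inclGL g).val) * (inclGL g⁻¹).val := by noncomm_ring
        _ = E' * ((inclGL h⁻¹).val * (inclGL h).val) * δ' * (inclGL g⁻¹).val := by
            rw [H]; noncomm_ring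
        _ = (inclGL g⁻¹).val := by rw [hh', mul_one, hδ'.inv_mul, one_mul]
    rw [sub_mul, this]
  have dk' : ((inclGL g⁻¹).val - y' * δ).DegLE 0 := hk' ▸ hyt'.mul hδ.deg
  set G := (inclGL g).val
  set G' := (inclGL g⁻¹).val with hG'
  set K := (inclGL h).val with hK
  set K' := (inclGL h⁻¹).val
  set u := G * y' + y * (K' - δ' * y') with hu
  set v := G' * y + y' * (K - δ * y) with hv
  have oc : (K - δ * y).OrdGE 0 := h0h.sub (hδ.ord.mul hy)
  have oc' : (K' - δ' * y').OrdGE 0 := h0h'.sub (hδ'.ord.mul hy')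
  have ou : u.OrdGE 0 := (h0g.mul hy').add (hy.mul oc')
  have dv : v.DegLE 0 := by
    rw [← one_mul v, ← hδ'.inv_mul, mul_assoc, e2]
    exact hδ'.deg_inv.mul (DegLE.one.sub (hyc'.mul hyc))
  have du : u.DegLE 0 := by
    rw [← one_mul u, ← hδ.inv_mul, mul_assoc, e1]
    exact hδ.deg_inv.mul (DegLE.one.sub (hyc.mul hyc'))
  obtain ⟨D, δ₀, hD, hδ₀, hDδ⟩ := exists_add_eq 1 δ
  -- `D` is the linear term of δ. In δu = 1 - cc' all but D u has degree at most 0, while D u has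
  -- order at least 1.
  have hDu : D * u = 0 := by
    refine eq_zero_of_ordGE_of_degLE (hD.mul ou) (e := 0) ?_ (by norm_num)
    have h1 : D * u = 1 - (K - δ * y) * (K' - δ' * y') - δ₀ * u := by
      rw [← e1, ← hDδ]
      noncomm_ring
    rw [h1]
    exact (DegLE.one.sub (hyc.mul hyc')).sub (hδ₀.mul du)
  have oW : (D * (G - y * δ')).OrdGE 0 :=
    (hD.mono zero_le_one).mul (h0g.sub (hy.mul hδ'.ord))
  obtain ⟨W, hW⟩ := oW.neg.exists_map_eq
  obtain ⟨Y, hY⟩ := hy.exists_map_eq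
  obtain ⟨Y', hY'⟩ := hy'.neg.exists_map_eq
  obtain ⟨Δ, hΔ⟩ := hδ.ord.exists_map_eq
  -- The bracket is the matrix of the cone, with rows (δ, -c) and (g⁻¹ - y'δ, v); only δ may have
  -- positive degree. The row operation `W` removes its linear term, and D u = 0 keeps the other
  -- entry of that row unchanged.
  let Z := upperGL W * (lowerGL Y' * blockDiagGL 1 g⁻¹ * upperGL Δ *
    rotGL (twistedPowerSeries ρ) ι * blockDiagGL 1 h * upperGL Y)
  have hZ : (inclGL Z).val = fromBlocks δ₀ (-(K - δ * y)) (G' - y' * δ) v := by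
    simp only [Z, map_mul, mapMatrixGL_upperGL, mapMatrixGL_lowerGL, mapMatrixGL_blockDiagGL,
      mapMatrixGL_rotGL, Units.val_mul, coe_upperGL, coe_lowerGL, coe_blockDiagGL, coe_rotGL, hW,
      hY, hY', hΔ, map_one, Units.val_one, fromBlocks_multiply, ← hG', ← hK]
    simp only [Matrix.one_mul, Matrix.mul_one, Matrix.zero_mul, Matrix.mul_zero, add_zero,
        zero_add, Matrix.mul_neg, Matrix.neg_mul]
    rw [fromBlocks_inj]
    refine ⟨?_, ?_, ?_, ?_⟩
    · calc _ = δ - D * ((G - y * δ') * (G' - y' * δ)) := by noncomm_ring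
        _ = δ - D + (D * u) * δ := by rw [e3]; noncomm_ring
        _ = δ₀ := by rw [hDu, ← hDδ]; noncomm_ring
    · calc _ = -(K - δ * y) - D * ((G - y * δ') * v) := by rw [hv]; noncomm_ring
        _ = -(K - δ * y) - (D * u) * (K - δ * y) := by rw [e4]; noncomm_ring
        _ = -(K - δ * y) := by rw [hDu]; noncomm_ring
    · noncomm_ring
    · rw [hv]
      noncomm_ring
  have h1 : wtors Z = 0 := by
    refine wtors_eq_zero_of_degLE ?_
    change (inclGL Z).val.DegLE 0
    rw [hZ]
    exact .fromBlocks hδ₀ hyc.neg dk' dv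
  simp only [Z, wtors_mul, wtors_upperGL, wtors_lowerGL, wtors_blockDiagGL, wtors_rotGL, wtors_one,
    wtors_inv, zero_add, add_zero] at h1
  exact neg_add_eq_zero.1 h1

end

/-! ### Factorizations through monic pencils: uniqueness, products, stabilisation. -/

noncomputable section

open KTheory Matrix NovikovRing

variable {A : Type*} [Ring A] {ρ : A ≃+* A} {ι κ : Type*} [Fintype ι] [DecidableEq ι] [Fintype κ]
  [DecidableEq κ]

theorem isMonicPair_one : IsMonicPair (1 : Matrix ι ι (NovikovRing ρ)) 1 where
  ord := .one
  deg := DegLE.one.mono zero_le_one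
  deg_inv := .one
  mul_inv := one_mul 1
  inv_mul := one_mul 1

theorem IsMonicPair.fromBlocks {δ E : Matrix ι ι (NovikovRing ρ)}
    {δ' E' : Matrix κ κ (NovikovRing ρ)}
    {c : Matrix κ ι (NovikovRing ρ)} (h : IsMonicPair δ E) (h' : IsMonicPair δ' E')
    (hc : c.OrdGE 0) (hc' : c.DegLE 0) :
    IsMonicPair (Matrix.fromBlocks δ 0 c δ') (Matrix.fromBlocks E 0 (-(E' * c * E)) E') where
  ord := .fromBlocks h.ord .zero hc h'.ord
  deg := .fromBlocks h.deg .zero (hc'.mono zero_le_one) h'.deg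
  deg_inv := .fromBlocks h.deg_inv .zero ((h'.deg_inv.mul hc').mul h.deg_inv).neg h'.deg_inv
  mul_inv := by
    have h1 : δ' * (E' * c * E) = c * E := by
      rw [← Matrix.mul_assoc, ← Matrix.mul_assoc, h'.mul_inv, Matrix.one_mul]
    simp [fromBlocks_multiply, h.mul_inv, h'.mul_inv, h1]
  inv_mul := by
    have h1 : E' * c * E * δ = E' * c := by
      rw [Matrix.mul_assoc _ E, h.inv_mul, Matrix.mul_one]
    simp [fromBlocks_multiply, h.inv_mul, h'.inv_mul, h1]

theorem IsMonicPair.submatrix {δ E : Matrix ι ι (NovikovRing ρ)} (h : IsMonicPair δ E)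
    (e : κ ≃ ι) : IsMonicPair (δ.submatrix e e) (E.submatrix e e) where
  ord i j := h.ord (e i) (e j)
  deg i j := h.deg (e i) (e j)
  deg_inv i j := h.deg_inv (e i) (e j)
  mul_inv := by rw [submatrix_mul_equiv, h.mul_inv, submatrix_one_equiv]
  inv_mul := by rw [submatrix_mul_equiv, h.inv_mul, submatrix_one_equiv]

/-- `M = g δ h` with `g`, `h` invertible over `A_ρ[[z]]` and `δ` monic, and `y` is the Witt vector
part of the torsion of `g` and `h`. -/
def HasFactorization (M : Matrix ι ι (NovikovRing ρ)) (y : K1 (twistedPowerSeries ρ)) : Prop :=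
  ∃ (g h : GL ι (twistedPowerSeries ρ)) (δ E : Matrix ι ι (NovikovRing ρ)), IsMonicPair δ E ∧
    M = (inclGL g).val * δ * (inclGL h).val ∧ y = wtors g + wtors h

namespace HasFactorization

variable {M N : Matrix ι ι (NovikovRing ρ)} {x y : K1 (twistedPowerSeries ρ)}

theorem unique (hx : HasFactorization M x) (hy : HasFactorization M y) : x = y := by
  obtain ⟨g, h, δ, E, hδ, hM, rfl⟩ := hx
  obtain ⟨g', h', δ', E', hδ', hM', rfl⟩ := hy
  have H : δ * (inclGL (h * h'⁻¹)).val = (inclGL (g⁻¹ * g')).val * δ' := by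
    have h1 : (inclGL g⁻¹).val * (inclGL g).val = 1 := by rw [← Units.val_mul, ← map_mul]; simp
    have h2 : (inclGL h').val * (inclGL h'⁻¹).val = 1 := by rw [← Units.val_mul, ← map_mul]; simp
    rw [map_mul, map_mul, Units.val_mul, Units.val_mul]
    calc _ = (inclGL g⁻¹).val * (inclGL g).val * δ * (inclGL h).val * (inclGL h'⁻¹).val := by
          rw [h1, one_mul, mul_assoc]
      _ = (inclGL g⁻¹).val * ((inclGL g).val * δ * (inclGL h).val) * (inclGL h'⁻¹).val := by
          noncomm_ring
      _ = (inclGL g⁻¹).val * (inclGL g').val * δ' * ((inclGL h').val * (inclGL h'⁻¹).val) := by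
          rw [← hM, hM']; noncomm_ring
      _ = _ := by rw [h2, mul_one]
  have h3 := wtors_eq_of_mul_eq_mul hδ hδ' H
  rw [wtors_mul, wtors_mul, wtors_inv, wtors_inv, ← sub_eq_add_neg, neg_add_eq_sub,
    sub_eq_sub_iff_add_eq_add] at h3
  rw [add_comm, h3]

theorem inclGL_mul (hx : HasFactorization M x) (g : GL ι (twistedPowerSeries ρ)) :
    HasFactorization ((inclGL g).val * M) (wtors g + x) := by
  obtain ⟨g', h, δ, E, hδ, rfl, rfl⟩ := hx
  refine ⟨g * g', h, δ, E, hδ, ?_, ?_⟩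
  · rw [map_mul, Units.val_mul]
    noncomm_ring
  · rw [wtors_mul, add_assoc]

theorem mul_inclGL (hx : HasFactorization M x) (g : GL ι (twistedPowerSeries ρ)) :
    HasFactorization (M * (inclGL g).val) (x + wtors g) := by
  obtain ⟨g', h, δ, E, hδ, rfl, rfl⟩ := hx
  refine ⟨g', h * g, δ, E, hδ, ?_, ?_⟩
  · rw [map_mul, Units.val_mul]
    noncomm_ring
  · rw [wtors_mul, add_assoc]

theorem of_isMonicPair {δ E : Matrix ι ι (NovikovRing ρ)} (hδ : IsMonicPair δ E) :
    HasFactorization δ 0 :=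
  ⟨1, 1, δ, E, hδ, by simp, by rw [wtors_one, add_zero]⟩

theorem inclGL (g : GL ι (twistedPowerSeries ρ)) : HasFactorization (inclGL g).val (wtors g) := by
  simpa using (of_isMonicPair isMonicPair_one).inclGL_mul g

theorem submatrix (hx : HasFactorization M x) (e : κ ≃ ι) :
    HasFactorization (M.submatrix e e) x := by
  obtain ⟨g, h, δ, E, hδ, rfl, rfl⟩ := hx
  refine ⟨reindexGL e.symm g, reindexGL e.symm h, _, _, hδ.submatrix e, ?_, ?_⟩
  · rw [← submatrix_mul_equiv _ _ e e e, ← submatrix_mul_equiv _ _ e e e]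
    rfl
  · rw [wtors_reindexGL, wtors_reindexGL]

theorem fromBlocks_one (hx : HasFactorization M x) :
    HasFactorization (fromBlocks M 0 0 (1 : Matrix κ κ (NovikovRing ρ))) x := by
  obtain ⟨g, h, δ, E, hδ, rfl, rfl⟩ := hx
  refine ⟨blockDiagGL g 1, blockDiagGL h 1, _, _, hδ.fromBlocks isMonicPair_one .zero .zero,
    ?_, ?_⟩
  · simp [mapMatrixGL_blockDiagGL, coe_blockDiagGL, fromBlocks_multiply]
  · rw [wtors_blockDiagGL, wtors_blockDiagGL, wtors_one, add_zero, add_zero]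

/-- The triangular pencil with rows (δ, 0) and (c, δ'), where c = g⁻¹ - δ'y is constant, is monic.
Elementary operations restore g⁻¹ in the corner; scaling the first column by g and clearing the
blocks then produces δgδ' ⊕ 1. -/
theorem mul (hx : HasFactorization M x) (hy : HasFactorization N y) :
    HasFactorization (fromBlocks (M * N) 0 0 (1 : Matrix ι ι (NovikovRing ρ))) (x + y) := by
  obtain ⟨g₁, g₂, δ, E, hδ, rfl, rfl⟩ := hx
  obtain ⟨g₃, g₄, δ', E', hδ', rfl, rfl⟩ := hy
  -- Only the product g = g₂g₃ of the two inner factors matters.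
  obtain ⟨g, rfl⟩ : ∃ g, g₃ = g₂⁻¹ * g := ⟨g₂ * g₃, by group⟩
  have hgg : (_root_.inclGL g⁻¹).val * (_root_.inclGL g).val = 1 := by
    rw [← Units.val_mul, ← map_mul]; simp
  obtain ⟨y, hy, -, hc⟩ := hδ'.exists_div (_root_.inclGL g⁻¹)
  have oc := (ordGE_inclGL g⁻¹).sub (hδ'.ord.mul hy)
  obtain ⟨Y, rfl⟩ := hy.exists_map_eq
  obtain ⟨Δ, rfl⟩ := hδ.ord.exists_map_eq
  obtain ⟨Δ', rfl⟩ := hδ'.ord.exists_map_eq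
  have h := (((((((of_isMonicPair (hδ.fromBlocks hδ' oc hc)).mul_inclGL
    (lowerGL Y)).mul_inclGL (blockDiagGL g 1)).mul_inclGL (upperGL (-Δ'))).mul_inclGL
    (rotGL _ ι)⁻¹).inclGL_mul (upperGL (-(Δ * g.val)))).inclGL_mul
    (blockDiagGL g₁ 1)).mul_inclGL (blockDiagGL g₄ 1)
  convert h using 1
  · have h1 : (_root_.inclGL g₂).val * (_root_.inclGL (g₂⁻¹ * g)).val = (_root_.inclGL g).val := by
      rw [← Units.val_mul, ← map_mul, mul_inv_cancel_left]
    have h2 : (_root_.inclGL (rotGL (twistedPowerSeries ρ) ι)⁻¹).val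
        = Matrix.fromBlocks 0 1 (-1) 0 := by
      rw [map_inv, mapMatrixGL_rotGL]
      rfl
    have h3 (X Z : Matrix ι ι (twistedPowerSeries ρ)) :
        (-(X * Z)).map (twistedPowerSeries ρ).subtype = -(X.map (twistedPowerSeries ρ).subtype *
          Z.map (twistedPowerSeries ρ).subtype) := by
      rw [Matrix.map_neg _ (map_neg _), Matrix.map_mul]
    have h4 : (-Δ').map (twistedPowerSeries ρ).subtype = -Δ'.map (twistedPowerSeries ρ).subtype :=
      Matrix.map_neg _ (map_neg _) _
    simp only [h2, h3, h4, ← coe_mapMatrixGL, mapMatrixGL_upperGL, mapMatrixGL_lowerGL,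
      mapMatrixGL_blockDiagGL, coe_upperGL, coe_lowerGL, coe_blockDiagGL, map_one, Units.val_one, fromBlocks_multiply]
    simp only [Matrix.one_mul, Matrix.mul_one, Matrix.zero_mul, Matrix.mul_zero, add_zero,
      zero_add, Matrix.mul_neg, sub_add_cancel, hgg]
    rw [fromBlocks_inj]
    refine ⟨?_, ?_, ?_, rfl⟩
    · calc _ = (_root_.inclGL g₁).val * Δ.map (twistedPowerSeries ρ).subtype *
            ((_root_.inclGL g₂).val * (_root_.inclGL (g₂⁻¹ * g)).val) *
            Δ'.map (twistedPowerSeries ρ).subtype * (_root_.inclGL g₄).val := by noncomm_ring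
        _ = _ := by
          rw [h1]
          noncomm_ring
    · rw [add_neg_cancel, mul_zero]
    · simp
  · simp only [wtors_mul, wtors_upperGL, wtors_lowerGL, wtors_blockDiagGL, wtors_rotGL, wtors_one,
      wtors_inv]
    abel

theorem sum_one {ν : Type*} [Fintype ν] [DecidableEq ν]
    (hx : HasFactorization (Matrix.fromBlocks M 0 0 (1 : Matrix κ κ (NovikovRing ρ))) x) :
    HasFactorization (Matrix.fromBlocks M 0 0 (1 : Matrix (κ ⊕ ν) (κ ⊕ ν) (NovikovRing ρ))) x := by
  convert (hx.fromBlocks_one (κ := ν)).submatrix (Equiv.sumAssoc ι κ ν).symm using 1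
  ext1 i j
  rcases i with i | i | i <;> rcases j with j | j | j <;> simp [Matrix.one_apply]

theorem of_equiv {ν : Type*} [Fintype ν] [DecidableEq ν] (e : κ ≃ ν)
    (hx : HasFactorization (Matrix.fromBlocks M 0 0 (1 : Matrix κ κ (NovikovRing ρ))) x) :
    HasFactorization (Matrix.fromBlocks M 0 0 (1 : Matrix ν ν (NovikovRing ρ))) x := by
  convert hx.submatrix (Equiv.sumCongr (Equiv.refl ι) e.symm) using 1
  ext1 i j
  rcases i with i | i <;> rcases j with j | j <;> simp [Matrix.one_apply]

end HasFactorization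

/-- A factorization of a matrix `M` after stabilisation. -/
def HasStableFactorization (M : Matrix ι ι (NovikovRing ρ)) (y : K1 (twistedPowerSeries ρ)) :
    Prop :=
  ∃ l : ℕ, HasFactorization (fromBlocks M 0 0 (1 : Matrix (Fin l) (Fin l) (NovikovRing ρ))) y

theorem HasFactorization.hasStableFactorization {M : Matrix ι ι (NovikovRing ρ)}
    {x : K1 (twistedPowerSeries ρ)} (hx : HasFactorization M x) : HasStableFactorization M x :=
  ⟨0, hx.fromBlocks_one⟩

namespace HasStableFactorization

variable {M N : Matrix ι ι (NovikovRing ρ)} {x y : K1 (twistedPowerSeries ρ)}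

theorem of_fintype
    (hx : HasFactorization (fromBlocks M 0 0 (1 : Matrix κ κ (NovikovRing ρ))) x) :
    HasStableFactorization M x := ⟨_, hx.of_equiv (Fintype.equivFin κ)⟩

theorem of_fromBlocks_one
    (hx : HasStableFactorization (fromBlocks M 0 0 (1 : Matrix κ κ (NovikovRing ρ))) x) :
    HasStableFactorization M x := by
  obtain ⟨l, hl⟩ := hx
  refine of_fintype (κ := κ ⊕ Fin l) ?_
  convert hl.submatrix (Equiv.sumAssoc ι κ (Fin l)).symm using 1
  ext1 i j
  rcases i with i | i | i <;> rcases j with j | j | j <;> simp [Matrix.one_apply]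

theorem submatrix (hx : HasStableFactorization M x) (e : κ ≃ ι) :
    HasStableFactorization (M.submatrix e e) x := by
  obtain ⟨l, hl⟩ := hx
  refine ⟨l, ?_⟩
  convert hl.submatrix (Equiv.sumCongr e (Equiv.refl (Fin l))) using 1
  ext1 i j
  rcases i with i | i <;> rcases j with j | j <;> simp [Matrix.one_apply]

theorem fromBlocks_one (hx : HasStableFactorization M x) :
    HasStableFactorization (fromBlocks M 0 0 (1 : Matrix κ κ (NovikovRing ρ))) x := by
  obtain ⟨l, hl⟩ := hx
  refine ⟨l, ?_⟩
  convert ((hl.sum_one (ν := κ)).of_equiv (Equiv.sumComm _ _)).submatrix (Equiv.sumAssoc _ _ _)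
    using 1
  ext1 i j
  rcases i with (i | i) | i <;> rcases j with (j | j) | j <;> simp [Matrix.one_apply]

theorem unique (hx : HasStableFactorization M x) (hy : HasStableFactorization M y) : x = y := by
  obtain ⟨l, hl⟩ := hx
  obtain ⟨m, hm⟩ := hy
  exact (hl.sum_one (ν := Fin m)).unique ((hm.sum_one (ν := Fin l)).of_equiv (Equiv.sumComm _ _))

theorem mul (hx : HasStableFactorization M x) (hy : HasStableFactorization N y) :
    HasStableFactorization (M * N) (x + y) := by
  obtain ⟨l, hl⟩ := hx
  obtain ⟨m, hm⟩ := hy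
  have h := (hl.sum_one (ν := Fin m)).mul
    ((hm.sum_one (ν := Fin l)).of_equiv (Equiv.sumComm _ _))
  rw [fromBlocks_multiply] at h
  simp only [Matrix.zero_mul, Matrix.mul_zero, add_zero, zero_add, Matrix.mul_one] at h
  exact of_fromBlocks_one (of_fintype h)

theorem inclGL (g : GL ι (twistedPowerSeries ρ)) :
    HasStableFactorization (inclGL g).val (wtors g) :=
  (HasFactorization.inclGL g).hasStableFactorization

end HasStableFactorization

end

/-! ### Existence of stable factorizations for matrices without negative powers of z. -/

noncomputable section

open KTheory Matrix NovikovRing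

section Scalar

variable {A : Type*} [Ring A] {ρ : A ≃+* A} {ι κ : Type*} [Fintype ι] [DecidableEq ι] [Fintype κ]
  [DecidableEq κ]

/-- The scalar matrix `z`. -/
def zGL (ρ : A ≃+* A) (ι : Type*) [Fintype ι] [DecidableEq ι] : GL ι (NovikovRing ρ) :=
  Units.map (Matrix.scalar ι).toMonoidHom (NovikovRing.z ρ)

theorem ordGE_zGL : (zGL ρ ι).val.OrdGE 1 := OrdGE.scalar (monomial_mem_ordGE 1 1)

theorem degLE_zGL : (zGL ρ ι).val.DegLE 1 := DegLE.scalar (monomial_mem_degLE 1 1)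

theorem ordGE_zGL_inv : (zGL ρ ι)⁻¹.val.OrdGE (-1) := OrdGE.scalar (monomial_mem_ordGE (-1) 1)

theorem degLE_zGL_inv : (zGL ρ ι)⁻¹.val.DegLE (-1) := DegLE.scalar (monomial_mem_degLE (-1) 1)

theorem isMonicPair_zGL : IsMonicPair (zGL ρ ι).val (zGL ρ ι)⁻¹.val where
  ord := ordGE_zGL.mono zero_le_one
  deg := degLE_zGL
  deg_inv := degLE_zGL_inv.mono (by norm_num)
  mul_inv := (zGL ρ ι).mul_inv
  inv_mul := (zGL ρ ι).inv_mul

theorem blockDiagGL_zGL : blockDiagGL (zGL ρ ι) (zGL ρ κ) = zGL ρ (ι ⊕ κ) := by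
  refine Units.ext ?_
  ext1 i j
  rcases i with i | i <;> rcases j with j | j <;>
    simp [coe_blockDiagGL, zGL, Matrix.diagonal_apply]

theorem reindexGL_zGL (e : ι ≃ κ) : reindexGL e (zGL ρ ι) = zGL ρ κ := by
  refine Units.ext ?_
  ext1 i j
  simp [coe_reindexGL, zGL, Matrix.diagonal_apply]

end Scalar

section Existence

universe u

variable {A : Type*} [Ring A] {ρ : A ≃+* A} {ι κ : Type u} [Fintype ι] [DecidableEq ι] [Fintype κ]
  [DecidableEq κ]

theorem exists_inclGL_eq {P Q : Matrix ι ι (NovikovRing ρ)} (hP : P.OrdGE 0) (hQ : Q.OrdGE 0)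
    (h : P * Q = 1) (h' : Q * P = 1) :
    ∃ g : GL ι (twistedPowerSeries ρ), (inclGL g).val = P ∧ (inclGL g⁻¹).val = Q := by
  obtain ⟨P, rfl⟩ := hP.exists_map_eq
  obtain ⟨Q, rfl⟩ := hQ.exists_map_eq
  rw [← Matrix.map_mul] at h h'
  refine ⟨⟨P, Q, map_subtype_injective ?_, map_subtype_injective ?_⟩, rfl, rfl⟩
  · exact h.trans (Matrix.map_one _ (map_zero _) (map_one _)).symm
  · exact h'.trans (Matrix.map_one _ (map_zero _) (map_one _)).symm

theorem exists_inclGL_eq_one_sub {X : Matrix ι ι (NovikovRing ρ)} (hX : X.OrdGE 1) :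
    ∃ g : GL ι (twistedPowerSeries ρ), (inclGL g).val = 1 - X := by
  obtain ⟨G, hG, h1, h2⟩ := exists_inverse_one_sub hX
  obtain ⟨g, hg, -⟩ := exists_inclGL_eq (OrdGE.one.sub (hX.mono zero_le_one)) hG h1 h2
  exact ⟨g, hg⟩

/-- An invertible linear pencil `M = a + b z` is the product of a monic one and a matrix which is
invertible over `A_ρ[[z]]`. -/
theorem exists_hasFactorization_of_degLE_one (M : GL ι (NovikovRing ρ)) (hM : M.val.OrdGE 0)
    (hM' : M.val.DegLE 1) : ∃ y, HasFactorization M.val y := by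
  have h1 : M.val * M⁻¹.val = 1 := M.mul_inv
  have h2 : M⁻¹.val * M.val = 1 := M.inv_mul
  generalize M.val = m at *
  generalize M⁻¹.val = n at *
  -- The inverse n splits into its power series part p, with constant term e, and its part q in
  -- negative degrees; the pencil is m = a + D with D its linear term.
  obtain ⟨p, q, hp, hq, hpq⟩ := exists_add_eq 0 n
  obtain ⟨D, a, hD, ha, hDa⟩ := exists_add_eq 1 m
  obtain ⟨e', e, he', he, hee⟩ := exists_add_eq 1 p
  rw [sub_self] at ha he
  rw [zero_sub] at hq
  have oa : a.OrdGE 0 := by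
    rw [← add_sub_cancel_left D a, hDa]
    exact hM.sub (hD.mono zero_le_one)
  have oe : e.OrdGE 0 := by
    rw [← add_sub_cancel_left e' e, hee]
    exact hp.sub (he'.mono zero_le_one)
  have dD : D.DegLE 1 := by
    rw [← add_sub_cancel_right D a, hDa]
    exact hM'.sub (ha.mono zero_le_one)
  -- Comparing order and degree, mp = 1 - mq and pm = 1 - qm have entries in `A`. By `f1` and `f2`
  -- these are idempotents; they separate the part of m with inverse in power series from the part
  -- with inverse in negative powers.
  have hmp : m * p = 1 - m * q := by rw [← h1, ← hpq]; noncomm_ring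
  have hpm : p * m = 1 - q * m := by rw [← h2, ← hpq]; noncomm_ring
  have dmq : (m * q).DegLE 0 := hM'.mul hq
  have dqm : (q * m).DegLE 0 := hq.mul hM'
  have omp : (m * p).OrdGE 0 := hM.mul hp
  have opm : (p * m).OrdGE 0 := hp.mul hM
  have dmp : (m * p).DegLE 0 := hmp ▸ DegLE.one.sub dmq
  have dpm : (p * m).DegLE 0 := hpm ▸ DegLE.one.sub dqm
  have omq : (m * q).OrdGE 0 := by
    rw [show m * q = 1 - m * p by rw [hmp]; noncomm_ring]
    exact OrdGE.one.sub omp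
  have oqm : (q * m).OrdGE 0 := by
    rw [show q * m = 1 - p * m by rw [hpm]; noncomm_ring]
    exact OrdGE.one.sub opm
  have f1 : p * m * q = 0 := by
    refine eq_zero_of_ordGE_of_degLE (d := 0) ?_ (dpm.mul hq) (by norm_num)
    rw [mul_assoc]
    exact hp.mul omq
  have f2 : q * m * p = 0 := by
    refine eq_zero_of_ordGE_of_degLE (oqm.mul hp) (e := -1) ?_ (by norm_num)
    rw [mul_assoc]
    exact hq.mul dmp
  have f3 : a * e = m * p := by
    refine (sub_eq_zero.1 (eq_zero_of_ordGE_of_degLE (d := 1) ?_ (dmp.sub (ha.mul he))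
      (by norm_num))).symm
    rw [show m * p - a * e = D * e + m * e' by rw [← hee, ← hDa]; noncomm_ring]
    exact (hD.mul oe).add (hM.mul he')
  have f4 : q * m * e = 0 := by
    refine eq_zero_of_ordGE_of_degLE (d := 1) ?_ (dqm.mul he) (by norm_num)
    rw [show q * m * e = q * m * p - q * m * e' by rw [← hee]; noncomm_ring, f2, zero_sub]
    exact (oqm.mul he').neg
  have f5 : m * q * D * e = 0 := by
    refine eq_zero_of_ordGE_of_degLE ((omq.mul hD).mul oe) (e := 0) ?_ (by norm_num)
    rw [show m * q * D * e = m * (q * m * e) - m * q * (a * e) by rw [← hDa]; noncomm_ring, f4,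
      mul_zero, zero_sub]
    exact (dmq.mul (ha.mul he)).neg
  have f6 : m * p * a = a * (p * m) := by
    refine sub_eq_zero.1 (eq_zero_of_ordGE_of_degLE (d := 1) ?_ ((dmp.mul ha).sub (ha.mul dpm))
      (by norm_num))
    rw [show m * p * a - a * (p * m) = D * (p * m) - m * p * D by rw [← hDa]; noncomm_ring]
    exact (hD.mul opm).sub (omp.mul hD)
  obtain ⟨g, hg⟩ := exists_inclGL_eq_one_sub (hp.mul hD)
  have hgg : (inclGL g).val * (inclGL g⁻¹).val = 1 := by rw [← Units.val_mul, ← map_mul]; simp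
  have hgg' : (inclGL g⁻¹).val * (inclGL g).val = 1 := by rw [← Units.val_mul, ← map_mul]; simp
  -- Here m(1 - pD) = a + mqD: the linear term survives only on the second part, which makes the
  -- pencil monic, and 1 - pD is invertible over the power series.
  have hδ : m * (1 - p * D) * (q + e) = 1 := by
    calc m * (1 - p * D) * (q + e)
        = m * q + m * e - m * p * m * q + m * p * a * q - m * p * D * e := by
          rw [← hDa]; noncomm_ring
      _ = m * q + m * e - m * (p * m * q) + a * (p * m * q) - (1 - m * q) * D * e := by
          rw [f6, ← hmp]; noncomm_ring
      _ = m * q + (m - D) * e + m * q * D * e := by rw [f1]; noncomm_ring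
      _ = m * q + a * e := by rw [f5, ← hDa]; noncomm_ring
      _ = 1 := by rw [f3, hmp]; noncomm_ring
  have hpair : IsMonicPair (m * (1 - p * D)) (q + e) := by
    refine ⟨?_, ?_, (hq.mono (by norm_num)).add he, hδ, ?_⟩
    · exact hM.mul (OrdGE.one.sub ((hp.mul hD).mono zero_le_one))
    · rw [mul_sub, mul_one, ← mul_assoc]
      exact hM'.sub (dmp.mul dD)
    · have h3 : (inclGL g⁻¹).val * n * (m * (1 - p * D)) = 1 := by
        rw [mul_assoc, ← mul_assoc n, h2, one_mul, ← hg, hgg']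
      rw [← left_inv_eq_right_inv h3 hδ, h3]
  have h := (HasFactorization.of_isMonicPair hpair).mul_inclGL g⁻¹
  rw [mul_assoc, ← hg, hgg, mul_one] at h
  exact ⟨_, h⟩

/-- Higman's linearisation: with M = r + zq, elementary operations turn M ⊕ 1 into the matrix with
rows (r, z) and (-q, 1), which lowers the degree by one until a pencil remains. -/
theorem exists_hasStableFactorization_of_degLE (d : ℕ) (M : GL ι (NovikovRing ρ))
    (hM : M.val.OrdGE 0) (hM' : M.val.DegLE (d + 1)) : ∃ y, HasStableFactorization M.val y := by
  induction d generalizing ι with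
  | zero =>
    obtain ⟨y, hy⟩ := exists_hasFactorization_of_degLE_one M hM (by simpa using hM')
    exact ⟨y, hy.hasStableFactorization⟩
  | succ d ih =>
    obtain ⟨P, r, hP, hr, hPr⟩ := exists_add_eq 1 M.val
    have or : r.OrdGE 0 := by
      rw [← add_sub_cancel_left P r, hPr]
      exact hM.sub (hP.mono zero_le_one)
    have dP : P.DegLE ((d + 1 : ℕ) + 1) := by
      rw [← add_sub_cancel_right P r, hPr]
      exact hM'.sub (hr.mono (by omega))
    have oq : ((zGL ρ ι)⁻¹.val * P).OrdGE 0 := ordGE_zGL_inv.mul hP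
    have dq : ((zGL ρ ι)⁻¹.val * P).DegLE (d + 1) :=
      (degLE_zGL_inv.mul dP).mono (by push_cast; omega)
    have hzq : (zGL ρ ι).val * ((zGL ρ ι)⁻¹.val * P) = P := by
      rw [← mul_assoc, (zGL ρ ι).mul_inv, one_mul]
    have oz : (zGL ρ ι).val.OrdGE 0 := ordGE_zGL.mono zero_le_one
    generalize (zGL ρ ι)⁻¹.val * P = q at *
    let N : GL (ι ⊕ ι) (NovikovRing ρ) := upperGL (zGL ρ ι).val * blockDiagGL M 1 * lowerGL (-q)
    have hN : N.val = fromBlocks r (zGL ρ ι).val (-q) 1 := by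
      simp only [N, Units.val_mul, coe_upperGL, coe_blockDiagGL, coe_lowerGL, Units.val_one,
        fromBlocks_multiply]
      rw [fromBlocks_inj]
      refine ⟨?_, ?_, ?_, ?_⟩ <;>
        simp only [Matrix.one_mul, Matrix.mul_one, Matrix.zero_mul, Matrix.mul_zero, add_zero,
          zero_add, Matrix.mul_neg, hzq]
      rw [← hPr, add_neg_cancel_comm]
    obtain ⟨y, hy⟩ := ih N
      (hN ▸ .fromBlocks or oz oq.neg .one)
      (hN ▸ .fromBlocks (hr.mono (by omega)) (degLE_zGL.mono (by omega)) dq.neg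
        (DegLE.one.mono (by omega)))
    obtain ⟨Q, rfl⟩ := oq.exists_map_eq
    obtain ⟨Z, hZ⟩ := oz.neg.exists_map_eq
    have h := ((HasStableFactorization.inclGL (upperGL Z)).mul hy).mul
      (HasStableFactorization.inclGL (lowerGL Q))
    have h3 : (inclGL (upperGL Z)).val * N.val * (inclGL (lowerGL Q)).val
        = (blockDiagGL M (1 : GL ι (NovikovRing ρ))).val := by
      rw [mapMatrixGL_upperGL, mapMatrixGL_lowerGL, hZ]
      rw [← Units.val_mul, ← Units.val_mul]
      simp only [N, upperGL_neg, lowerGL_neg]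
      congr 1
      group
    rw [h3] at h
    exact ⟨_, h.of_fromBlocks_one⟩

/-- If M⁻¹ has order at least -k and T collects the terms of M of degree > k, then 1 - M⁻¹T is
invertible over the power series and M(1 - M⁻¹T) = M - T is a polynomial. -/
theorem exists_hasStableFactorization (M : GL ι (NovikovRing ρ)) (hM : M.val.OrdGE 0) :
    ∃ y, HasStableFactorization M.val y := by
  obtain ⟨k, hk⟩ := exists_ordGE M⁻¹.val
  obtain ⟨T, p, hT, hp, hTp⟩ := exists_add_eq (k + 1) M.val
  have hX : (M⁻¹.val * T).OrdGE 1 := by simpa using hk.mul hT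
  obtain ⟨g, hg⟩ := exists_inclGL_eq_one_sub hX
  have h1 : (M * inclGL g).val = p := by
    rw [Units.val_mul, hg, mul_sub, ← mul_assoc, M.mul_inv, one_mul, mul_one, ← hTp,
      add_sub_cancel_left]
  have op : p.OrdGE 0 := by
    rw [← add_sub_cancel_left T p, hTp]
    exact hM.sub (hT.mono (by omega))
  obtain ⟨y, hy⟩ := exists_hasStableFactorization_of_degLE k (M * inclGL g) (h1 ▸ op)
    (h1 ▸ hp.mono (by omega))
  have h := hy.mul (HasStableFactorization.inclGL g⁻¹)
  rw [← Units.val_mul, mul_assoc, ← map_mul, mul_inv_cancel, map_one, mul_one] at h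
  exact ⟨_, h⟩

end Existence

end

/-! ### Construction of the left inverse. -/

noncomputable section

open KTheory Matrix NovikovRing

section WittTorsion

variable {A : Type*} [Ring A] {ρ : A ≃+* A} {ι κ : Type*} [Fintype ι] [DecidableEq ι] [Fintype κ]
  [DecidableEq κ]

theorem HasFactorization.ordGE {M : Matrix ι ι (NovikovRing ρ)} {y : K1 (twistedPowerSeries ρ)}
    (h : HasFactorization M y) : M.OrdGE 0 := by
  obtain ⟨g, g', δ, E, hδ, rfl, -⟩ := h
  exact ((ordGE_inclGL g).mul hδ.ord).mul (ordGE_inclGL g')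

theorem HasStableFactorization.ordGE {M : Matrix ι ι (NovikovRing ρ)}
    {y : K1 (twistedPowerSeries ρ)} (h : HasStableFactorization M y) : M.OrdGE 0 := by
  obtain ⟨l, hl⟩ := h
  exact fun i j ↦ hl.ordGE (Sum.inl i) (Sum.inl j)

theorem HasStableFactorization.mem_W1 {M : Matrix ι ι (NovikovRing ρ)}
    {y : K1 (twistedPowerSeries ρ)} (h : HasStableFactorization M y) : y ∈ W1 ρ := by
  obtain ⟨l, g, g', δ, E, -, -, rfl⟩ := h
  exact add_mem (wittPart_mem _) (wittPart_mem _)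

theorem HasStableFactorization.pow {M : GL ι (NovikovRing ρ)}
    (h : HasStableFactorization M.val 0) (k : ℕ) : HasStableFactorization (M ^ k).val 0 := by
  induction k with
  | zero => simpa using (HasFactorization.of_isMonicPair isMonicPair_one).hasStableFactorization
  | succ k ih =>
    rw [pow_succ, Units.val_mul, ← add_zero (0 : K1 (twistedPowerSeries ρ))]
    exact ih.mul h

theorem hasStableFactorization_zGL : HasStableFactorization (zGL ρ ι).val 0 :=
  (HasFactorization.of_isMonicPair isMonicPair_zGL).hasStableFactorization

/-- Conjugation by z preserves order, so some value exists; it is y, by uniqueness for the two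
products (zMz⁻¹)z = zM, since z contributes 0. -/
theorem HasStableFactorization.conj_zGL {M : GL ι (NovikovRing ρ)} {y : K1 (twistedPowerSeries ρ)}
    (h : HasStableFactorization M.val y) :
    HasStableFactorization (zGL ρ ι * M * (zGL ρ ι)⁻¹).val y := by
  obtain ⟨x, hx⟩ := exists_hasStableFactorization (zGL ρ ι * M * (zGL ρ ι)⁻¹)
    (by simpa using (ordGE_zGL.mul h.ordGE).mul ordGE_zGL_inv)
  have h1 := hx.mul hasStableFactorization_zGL
  have h2 := hasStableFactorization_zGL.mul h
  rw [← Units.val_mul] at h1 h2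
  rw [inv_mul_cancel_right, add_zero] at h1
  rw [zero_add] at h2
  rwa [← h1.unique h2]

theorem HasStableFactorization.conj_zGL_pow {M : GL ι (NovikovRing ρ)}
    {y : K1 (twistedPowerSeries ρ)} (h : HasStableFactorization M.val y) (k : ℕ) :
    HasStableFactorization (zGL ρ ι ^ k * M * (zGL ρ ι ^ k)⁻¹).val y := by
  induction k with
  | zero => simpa using h
  | succ k ih =>
    have h1 : zGL ρ ι ^ (k + 1) * M * (zGL ρ ι ^ (k + 1))⁻¹
      = zGL ρ ι * (zGL ρ ι ^ k * M * (zGL ρ ι ^ k)⁻¹) * (zGL ρ ι)⁻¹ := by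
      rw [pow_succ']
      group
    rw [h1]
    exact ih.conj_zGL

/-- The value `y` of `B̂₂` on the torsion of `M`. -/
def HasWittTorsion (M : GL ι (NovikovRing ρ)) (y : K1 (twistedPowerSeries ρ)) : Prop :=
  ∃ k : ℕ, HasStableFactorization (zGL ρ ι ^ k * M).val y

theorem HasStableFactorization.hasWittTorsion {M : GL ι (NovikovRing ρ)}
    {y : K1 (twistedPowerSeries ρ)} (h : HasStableFactorization M.val y) : HasWittTorsion M y :=
  ⟨0, by simpa using h⟩

theorem exists_hasWittTorsion (M : GL ι (NovikovRing ρ)) : ∃ y, HasWittTorsion M y := by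
  obtain ⟨k, hk⟩ := exists_ordGE M.val
  obtain ⟨y, hy⟩ := exists_hasStableFactorization (zGL ρ ι ^ k * M)
    (by simpa using (ordGE_zGL.pow k).mul hk)
  exact ⟨y, k, hy⟩

namespace HasWittTorsion

variable {M N : GL ι (NovikovRing ρ)} {x y : K1 (twistedPowerSeries ρ)}

theorem mem_W1 (h : HasWittTorsion M y) : y ∈ W1 ρ := h.choose_spec.mem_W1

theorem unique (hx : HasWittTorsion M x) (hy : HasWittTorsion M y) : x = y := by
  obtain ⟨k, hk⟩ := hx
  obtain ⟨l, hl⟩ := hy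
  have h1 := (hasStableFactorization_zGL.pow l).mul hk
  have h2 := (hasStableFactorization_zGL.pow k).mul hl
  rw [← Units.val_mul, ← mul_assoc, ← pow_add, zero_add] at h1 h2
  rw [add_comm] at h1
  exact h1.unique h2

/-- As z is not central, the power of z belonging to N is moved past M by conjugation. -/
theorem mul (hx : HasWittTorsion M x) (hy : HasWittTorsion N y) :
    HasWittTorsion (M * N) (x + y) := by
  obtain ⟨k, hk⟩ := hx
  obtain ⟨l, hl⟩ := hy
  refine ⟨l + k, ?_⟩
  have h := (hk.conj_zGL_pow l).mul hl
  have h1 : zGL ρ ι ^ l * (zGL ρ ι ^ k * M) * (zGL ρ ι ^ l)⁻¹ * (zGL ρ ι ^ l * N)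
      = zGL ρ ι ^ (l + k) * (M * N) := by
    rw [pow_add]
    group
  rwa [← Units.val_mul, h1] at h

/-- The scalar matrix zᵏ also acts on the new identity block; the extra factor is a power of the
monic pencil 1 ⊕ z. -/
theorem blockDiagGL_one (hx : HasWittTorsion M x) :
    HasWittTorsion (blockDiagGL M (1 : GL κ (NovikovRing ρ))) x := by
  obtain ⟨k, hk⟩ := hx
  refine ⟨k, ?_⟩
  have h1 : HasStableFactorization (blockDiagGL (1 : GL ι (NovikovRing ρ)) (zGL ρ κ)).val 0 :=
    (HasFactorization.of_isMonicPair
      (isMonicPair_one.fromBlocks isMonicPair_zGL .zero .zero)).hasStableFactorization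
  have h2 := (h1.pow k).mul (hk.fromBlocks_one (κ := κ))
  have h3 : blockDiagGL (1 : GL ι (NovikovRing ρ)) (zGL ρ κ) ^ k *
      blockDiagGL (zGL ρ ι ^ k * M) 1 = zGL ρ (ι ⊕ κ) ^ k * blockDiagGL M 1 := by
    have h4 : ∀ k : ℕ, ∀ (g : GL ι (NovikovRing ρ)) (h : GL κ (NovikovRing ρ)),
        blockDiagGL g h ^ k = blockDiagGL (g ^ k) (h ^ k) := fun k g h ↦ by
      induction k with
      | zero =>
        refine Units.ext ?_
        simp [coe_blockDiagGL]
      | succ k ih => rw [pow_succ, ih, ← blockDiagGL_mul, pow_succ, pow_succ]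
    rw [← blockDiagGL_zGL, h4, h4, ← blockDiagGL_mul, ← blockDiagGL_mul, one_pow, one_mul]
  rw [← h3, ← zero_add x]
  exact h2

theorem reindexGL (hx : HasWittTorsion M x) (e : ι ≃ κ) :
    HasWittTorsion (reindexGL e M) x := by
  obtain ⟨k, hk⟩ := hx
  refine ⟨k, ?_⟩
  rw [← reindexGL_zGL e, ← map_pow, ← map_mul]
  exact hk.submatrix e.symm

end HasWittTorsion

/-- The homomorphism on invertible matrices underlying `B̂₂`. -/
def wittTorsion (ρ : A ≃+* A) (ι : Type*) [Fintype ι] [DecidableEq ι] :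
    GL ι (NovikovRing ρ) →* Multiplicative (K1 (twistedPowerSeries ρ)) :=
  MonoidHom.mk' (fun M ↦ .ofAdd (exists_hasWittTorsion M).choose) fun M N ↦
    (exists_hasWittTorsion (M * N)).choose_spec.unique
      ((exists_hasWittTorsion M).choose_spec.mul (exists_hasWittTorsion N).choose_spec)

theorem HasWittTorsion.eq {M : GL ι (NovikovRing ρ)} {y : K1 (twistedPowerSeries ρ)}
    (h : HasWittTorsion M y) : wittTorsion ρ ι M = .ofAdd y :=
  (exists_hasWittTorsion M).choose_spec.unique h

theorem hasWittTorsion_wittTorsion (M : GL ι (NovikovRing ρ)) :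
    HasWittTorsion M (wittTorsion ρ ι M).toAdd := (exists_hasWittTorsion M).choose_spec

theorem wittTorsion_stab {n m : ℕ} (h : n ≤ m) (M : GL (Fin n) (NovikovRing ρ)) :
    wittTorsion ρ (Fin n) M = wittTorsion ρ (Fin m) (stab (NovikovRing ρ) n m h M) := by
  rw [stab_eq_reindexGL]
  exact (((hasWittTorsion_wittTorsion M).blockDiagGL_one).reindexGL _).eq.symm

/-- The homomorphism on the stable general linear group underlying `B̂₂`. -/
def stableWittTorsion (ρ : A ≃+* A) :
    StableGL (NovikovRing ρ) →* Multiplicative (K1 (twistedPowerSeries ρ)) where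
  toFun := DirectLimit.lift (stab (NovikovRing ρ)) (fun n M ↦ wittTorsion ρ (Fin n) M)
    fun _ _ h M ↦ wittTorsion_stab h M
  map_one' := by
    rw [DirectLimit.one_def 0, DirectLimit.lift_def]
    exact map_one _
  map_mul' x y := by
    induction x, y using DirectLimit.induction₂ with
    | _ n M N =>
      simp only [DirectLimit.mul_def, DirectLimit.lift_def, map_mul]

/-- The homomorphism `B̂₂ : K₁(A_ρ((z))) → W₁(A,ρ)`, with values in `K₁(A_ρ[[z]])`. -/
def wittTorsionK1 (ρ : A ≃+* A) : K1 (NovikovRing ρ) →+ K1 (twistedPowerSeries ρ) :=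
  MonoidHom.toAdditiveLeft (Abelianization.lift (stableWittTorsion ρ))

theorem hasWittTorsion_wittTorsionK1 {n : ℕ} (M : GL (Fin n) (NovikovRing ρ)) :
    HasWittTorsion M (wittTorsionK1 ρ (torsion M)) := hasWittTorsion_wittTorsion M

theorem wittTorsionK1_mem_W1 (x : K1 (NovikovRing ρ)) : wittTorsionK1 ρ x ∈ W1 ρ := by
  obtain ⟨n, M, rfl⟩ := exists_torsion_eq x
  exact (hasWittTorsion_wittTorsionK1 M).mem_W1

/-- A matrix invertible over the power series is factorized with δ = 1 and no power of z, so the map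
extends `wittPart`. -/
theorem wittTorsionK1_map (x : K1 (twistedPowerSeries ρ)) :
    wittTorsionK1 ρ (K1.map (twistedPowerSeries ρ).subtype x) = wittPart ρ x := by
  obtain ⟨n, g, rfl⟩ := exists_torsion_eq x
  rw [← tors_fin g, map_tors, tors_fin]
  exact (hasWittTorsion_wittTorsionK1 _).unique (HasStableFactorization.inclGL g).hasWittTorsion

theorem wittPart_map_constPowerSeries (x : K1 A) :
    wittPart ρ (K1.map (constPowerSeries ρ) x) = 0 := by
  obtain ⟨n, g, rfl⟩ := exists_torsion_eq x
  rw [← tors_fin g, map_tors]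
  exact wtors_eq_zero_of_degLE fun i j ↦ monomial_mem_degLE 0 _

end WittTorsion

end

theorem mainTheorem2 {A : Type*} [Ring A] (ρ : A ≃+* A) :
    ∃ B2 : KTheory.K1 (NovikovRing ρ) →+ W1 ρ,
      B2.comp (C2 ρ) = AddMonoidHom.id (W1 ρ) ∧
      (∀ x : KTheory.K1 A, B2 (KTheory.K1.map (NovikovRing.C ρ) x) = 0) ∧
      B2 (KTheory.unitTorsion (NovikovRing ρ) (Additive.ofMul (NovikovRing.z ρ))) = 0 := by
  refine ⟨(wittTorsionK1 ρ).codRestrict (W1 ρ) wittTorsionK1_mem_W1, ?_, fun x ↦ ?_, ?_⟩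
  · ext x
    change wittTorsionK1 ρ (KTheory.K1.map (twistedPowerSeries ρ).subtype x) = _
    rw [wittTorsionK1_map, wittPart_eq_self x.2]
    rfl
  · refine Subtype.ext ?_
    have h : KTheory.K1.map (NovikovRing.C ρ) x = KTheory.K1.map (twistedPowerSeries ρ).subtype
        (KTheory.K1.map (constPowerSeries ρ) x) := by
      obtain ⟨n, g, rfl⟩ := KTheory.exists_torsion_eq x
      rfl
    change wittTorsionK1 ρ _ = 0
    rw [h, wittTorsionK1_map, wittPart_map_constPowerSeries]
  · refine Subtype.ext ?_
    exact (hasWittTorsion_wittTorsionK1 (zGL ρ (Fin 1))).unique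
      hasStableFactorization_zGL.hasWittTorsion
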